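/- Let $k$ be a natural number and let $p$ be a prime with $p>2^k$. A left brace is a set $A$ with operations $+,\circ$ such that $(A,+)$ is an abelian group, $(A,\circ)$ is a group and $a\circ(b+c)+a=a\circ b+a\circ c$; put $a*b=a\circ b-a-b$. It is an $\mathbb F_p$-brace if $(A,+)$ is an $\mathbb F_p$-vector space and $a*(\alpha b)=\alpha(a*b)$ for all $a,b\in A$, $\alpha\in\mathbb F_p$. Put $A^{[1]}=A$ and $A^{[i+1]}=\sum_{j=1}^{i}A^{[j]}*A^{[i+1-j]}$, where $X*Y$ is the additive subgroup generated by all $x*y$ with $x\in X$, $y\in Y$. The brace is strongly nilpotent of nilpotency index $k$ if $k$ is the least integer $n\ge 1$ with $A^{[n]}=0$. A pre-Lie algebra over $\mathbb F_p$ is an $\mathbb F_p$-vector space $A$ with a bilinear product satisfying $(x\cdot y)\cdot z-x\cdot(y\cdot z)=(y\cdot x)\cdot z-y\cdot(x\cdot z)$. It is nilpotent of nilpotency index $k$ if $k$ is the least integer $n\ge1$ such that all products of $n$ elements, with any distribution of brackets, are zero. For such an algebra with $p>2^k$ let $L_a(b)=a\cdot b$, $$e^{L_a}(b)=\sum_{n\ge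 0}\frac1{n!}L_a^n(b),\qquad W(a)=\sum_{n\ge 1}\frac1{n!}L_a^{n-1}(a),$$ where the sums stop at place $k$ (the later products vanish). The map $W:A\to A$ is bijective; let $\Omega$ be its inverse. The group of flows of the pre-Lie algebra $A$ is $A$ with the operation $a\circ b=a+e^{L_{\Omega(a)}}(b)$. Then for every $\mathbb F_p$-vector space $A$ the following two assignments, which leave the vector space unchanged, are well defined and mutually inverse bijections between the set of nilpotent pre-Lie algebra structures of nilpotency index $k$ on $A$ and the set of strongly nilpotent $\mathbb F_p$-brace structures of nilpotency index $k$ on $A$. A pre-Lie algebra is sent to its group of flows $(A,+,\circ)$. A brace is sent to the pre-Lie algebra with product $$a\cdot b=-\sum_{i=0}^{p-2}2^{-i}\bigl((2^i a)*b\bigr),$$ where $2^{-i}$ is the inverse of $2^i$ in $\mathbb F_p$. Moreover, an $\mathbb F_p$-linear bijection between two such vector spaces is an isomorphism of pre-Lie algebras if and only if it is an isomorphism of the corresponding braces, so the correspondence is also one between isomorphism classes. -/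

import Mathlib

open Finset

universe u

noncomputable section

/-- A left brace on the abelian group `(A, +)`: an operation `∘` making `A` a group and satisfying
`a ∘ (b + c) + a = a ∘ b + a ∘ c`. All fields other than `circ` are propositions, so a left brace
on `(A, +)` is determined by its operation `∘`. -/
@[ext]
structure LeftBrace (A : Type*) [AddCommGroup A] where
  /-- the operation `∘` -/
  circ : A → A → A
  circ_assoc : ∀ a b c, circ (circ a b) c = circ a (circ b c)
  exists_one_inv : ∃ e, (∀ a, circ e a = a ∧ circ a e = a) ∧
    ∀ a, ∃ b, circ a b = e ∧ circ b a = e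
  circ_add : ∀ a b c, circ a (b + c) + a = circ a b + circ a c

namespace LeftBrace

variable {A : Type*} [AddCommGroup A] (B : LeftBrace A)

/-- `a * b = a ∘ b - a - b`. -/
def star (a b : A) : A := B.circ a b - a - b

/-- The chain `A^{[1]} = A`, `A^{[i+1]} = ∑_{j=1}^{i} A^{[j]} * A^{[i+1-j]}`, where `X * Y` is the
additive subgroup generated by all `x * y` with `x ∈ X`, `y ∈ Y`. In the last clause the index
`j + 1` runs over `1, …, n + 1`. The chain starts at index `1`; the value at `0` is a
placeholder that is never used. -/
def strongChain : ℕ → AddSubgroup A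
  | 0 => ⊤
  | 1 => ⊤
  | n + 2 => ⨆ j : Fin (n + 1), AddSubgroup.closure
      {x | ∃ a ∈ strongChain (j.1 + 1), ∃ b ∈ strongChain (n + 1 - j.1), x = B.star a b}
  termination_by n => n
  decreasing_by all_goals omega

/-- The brace is strongly nilpotent of nilpotency index `k`: the number `k` is the least `n ≥ 1`
with `A^{[n]} = 0`. -/
def HasNilpotencyIndex (k : ℕ) : Prop :=
  IsLeast {n : ℕ | 1 ≤ n ∧ B.strongChain n = ⊥} k

end LeftBrace

/-- An `F`-brace on the `F`-vector space `A`: a left brace on the additive group of `A` such that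
`a * (α b) = α (a * b)`. -/
@[ext]
structure FieldBrace (F A : Type*) [Field F] [AddCommGroup A] [Module F A] extends
    LeftBrace A where
  star_smul : ∀ (a : A) (α : F) (b : A), toLeftBrace.star a (α • b) = α • toLeftBrace.star a b

/-- For an `𝔽_p`-brace, the operation `a · b = -∑_{i=0}^{p-2} 2^{-i} ((2^i a) * b)`. -/
def FieldBrace.dot {p : ℕ} [Fact p.Prime] {A : Type*} [AddCommGroup A] [Module (ZMod p) A]
    (B : FieldBrace (ZMod p) A) (a b : A) : A :=
  -∑ i ∈ range (p - 1), ((2 : ZMod p) ^ i)⁻¹ • B.star ((2 ^ i : ℕ) • a) b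

/-- A (left) pre-Lie algebra structure on the `F`-vector space `A`: a bilinear product with
`(x y) z - x (y z) = (y x) z - y (x z)`. -/
@[ext]
structure PreLieStructure (F A : Type*) [Field F] [AddCommGroup A] [Module F A] where
  /-- the product, as a bilinear map -/
  mul : A →ₗ[F] A →ₗ[F] A
  preLie : ∀ x y z, mul (mul x y) z - mul x (mul y z) = mul (mul y x) z - mul y (mul x z)

namespace PreLieStructure

variable {F A : Type*} [Field F] [AddCommGroup A] [Module F A] (P : PreLieStructure F A)

/-- The pre-Lie ring in the sense of Mathlib, with the given addition of `A`. -/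
abbrev toLeftPreLieRing : LeftPreLieRing A where
  mul a b := P.mul a b
  left_distrib a b c := map_add (P.mul a) b c
  right_distrib a b c := by
    change P.mul (a + b) c = P.mul a c + P.mul b c
    simp
  zero_mul a := by
    change P.mul 0 a = 0
    simp
  mul_zero a := map_zero (P.mul a)
  assoc_symm' x y z := P.preLie x y z

/-- It is a pre-Lie algebra over `F` in the sense of Mathlib, with the given scalar
multiplication of `A`. -/
abbrev toLeftPreLieAlgebra :
    letI := P.toLeftPreLieRing
    LeftPreLieAlgebra F A :=
  letI := P.toLeftPreLieRing
  { (inferInstance : Module F A) with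
    smul_assoc := fun r x y => by
      change P.mul (r • x) y = r • P.mul x y
      simp
    smul_comm := fun r x y => by
      change r • P.mul x y = P.mul x (r • y)
      simp }

/-- Every pre-Lie algebra in the sense of Mathlib arises in this way. -/
def ofLeftPreLieAlgebra (F L : Type*) [Field F] [LeftPreLieRing L] [LeftPreLieAlgebra F L] :
    PreLieStructure F L where
  mul := LinearMap.mul F L
  preLie x y z := LeftPreLieRing.assoc_symm x y z

/-- `P.IsProduct n x`: the element `x` is a product of `n` elements of `A`, with some distribution
of brackets. -/
inductive IsProduct : ℕ → A → Prop
  | single (a : A) : IsProduct 1 a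
  | mul {m n : ℕ} {a b : A} : IsProduct m a → IsProduct n b → IsProduct (m + n) (P.mul a b)

/-- The pre-Lie algebra is nilpotent of nilpotency index `k`: the number `k` is the least `n ≥ 1`
such that all products of `n` elements are zero. -/
def HasNilpotencyIndex (k : ℕ) : Prop :=
  IsLeast {n : ℕ | 1 ≤ n ∧ ∀ x, P.IsProduct n x → x = 0} k

/-- `e^{L_a}(b) = b + a · b + (1/2!) a · (a · b) + ⋯`, the sum being truncated after the
terms with fewer than `k` factors `a`. (If `k` is the nilpotency index, all later
terms contain a zero product.) -/
def expL (k : ℕ) (a b : A) : A :=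
  ∑ n ∈ range k, (n.factorial : F)⁻¹ • ((P.mul a) ^ n) b

/-- `W(a) = e^{L_a}(1) - 1 = a + (1/2!) a · a + (1/3!) a · (a · a) + ⋯`, truncated after the
products of `k` factors. -/
def W (k : ℕ) (a : A) : A :=
  ∑ n ∈ range k, ((n + 1).factorial : F)⁻¹ • ((P.mul a) ^ n) a

/-- The inverse function `Ω` of `W` (meaningful when `W` is bijective). -/
def Ω (k : ℕ) : A → A :=
  haveI : Nonempty A := ⟨0⟩
  Function.invFun (P.W k)

/-- The multiplication of the group of flows, `a ∘ b = a + e^{L_{Ω(a)}}(b)`. -/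
def flow (k : ℕ) (a b : A) : A := a + P.expL k (P.Ω k a) b

end PreLieStructure

end

/-! Both structures are read off from groups of operators on `𝔽_p × A`. A pre-Lie algebra gives the
operators N_a(s, b) = (0, s a + a · b); the pre-Lie identity says exactly that they satisfy [N_a,
N_b] = N_{ab - ba}, and exp N_a sends (s, b) to (s, s W(a) + e^{L_a}(b)). That these exponentials
are closed under multiplication is the associativity of the group of flows
(`truncExp_mul_truncExp`). A brace gives the operators 1 + S_a with S_a(s, b) = (0, s a + a * b),
and brace associativity gives (1 + S_a)(1 + S_b) = 1 + S_{a ∘ b}. So passing from braces to pre-Lie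
algebras means taking logarithms and showing that they form a Lie algebra, i.e. a linear space
closed under commutators (`log_add`, `log_lie`).

Lie theory in characteristic p is replaced by polynomial curves t ↦ f(t) on `𝔽_p` whose coefficient
of t^i lies in step i of a filtration that vanishes at step k. Products then keep degree below k,
and p > 2^k makes two things possible: coefficients can be extracted by sums over powers of 2
(`polyCoeff`), and the numbers 1, ..., k are invertible. This yields the operator t d/dt, a Leibniz
rule and uniqueness for linear differential equations, which together prove the exponential
identities. The formula for a · b in the theorem is just the coefficient of t in (t a) * b.

For the inverse direction, the logarithms of the 1 + S_a are parametrised by their value x at (1,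
0), giving a map X. Scaling comes from powers in the group. Additivity is proved by descending
induction along the strong chain, by comparing linear coefficients of log(exp(t X x) exp(t X y)).
Commutators come from the linear coefficient of a conjugation. The product x · y = X_x(0, y) is then
pre-Lie, and its group of flows is the given brace.

Finally, the strong chain of the brace of flows coincides with the powers of the pre-Lie algebra, so
the nilpotency indices agree. -/

noncomputable section

/-! ### Polynomial functions on `𝔽_p`, coefficient extraction and the Euler operator. -/

section PolynomialFunctions

variable {p : ℕ} [Fact p.Prime]
  {A A' A'' : Type*} [AddCommGroup A] [Module (ZMod p) A] [AddCommGroup A'] [Module (ZMod p) A']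
  [AddCommGroup A''] [Module (ZMod p) A'']

lemma two_pow_ne_zero_of_lt {k : ℕ} (hp : 2 ^ k < p) (hk : 0 < k) (j : ℕ) :
    (2 : ZMod p) ^ j ≠ 0 := by
  apply pow_ne_zero
  intro h
  have h2 : ((2 : ℕ) : ZMod p) = 0 := by exact_mod_cast h
  rw [ZMod.natCast_eq_zero_iff] at h2
  have h3 : 2 ^ 1 ≤ 2 ^ k := Nat.pow_le_pow_right (by norm_num) hk
  have := Nat.le_of_dvd (by norm_num) h2
  omega

/-- The numbers 1, 2, ..., 2^k are all smaller than p, hence distinct residues. The order of 2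
modulo p may still be smaller than p - 1. -/
lemma two_pow_injOn {k : ℕ} (hp : 2 ^ k < p) {i j : ℕ} (hi : i ≤ k) (hj : j ≤ k)
    (h : (2 : ZMod p) ^ i = 2 ^ j) : i = j := by
  have h' : ((2 ^ i : ℕ) : ZMod p) = ((2 ^ j : ℕ) : ZMod p) := by exact_mod_cast h
  rw [ZMod.natCast_eq_natCast_iff'] at h'
  have hi' : 2 ^ i ≤ 2 ^ k := Nat.pow_le_pow_right (by norm_num) hi
  have hj' : 2 ^ j ≤ 2 ^ k := Nat.pow_le_pow_right (by norm_num) hj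
  rw [Nat.mod_eq_of_lt (by omega), Nat.mod_eq_of_lt (by omega)] at h'
  exact Nat.pow_right_injective (le_refl 2) h'

lemma natCast_ne_zero_of_lt {n : ℕ} (hn : 0 < n) (hp : n < p) : (n : ZMod p) ≠ 0 := by
  rw [Ne, ZMod.natCast_eq_zero_iff]
  exact fun h => absurd (Nat.le_of_dvd hn h) (by omega)

/-- The coefficient of `t ^ m` of a polynomial function of small degree, obtained by summing over
the powers of `2`. -/
def polyCoeff (m : ℕ) : (ZMod p → A) →ₗ[ZMod p] A :=
  -∑ i ∈ range (p - 1), (((2 : ZMod p) ^ i) ^ m)⁻¹ • LinearMap.proj ((2 : ZMod p) ^ i)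

lemma polyCoeff_apply (m : ℕ) (f : ZMod p → A) :
    polyCoeff m f = -∑ i ∈ range (p - 1), (((2 : ZMod p) ^ i) ^ m)⁻¹ • f ((2 : ZMod p) ^ i) := by
  simp [polyCoeff]

lemma polyCoeff_mem (m : ℕ) (f : ZMod p → A) (S : Submodule (ZMod p) A) (h : ∀ t, f t ∈ S) :
    polyCoeff m f ∈ S := by
  rw [polyCoeff_apply]
  exact S.neg_mem (S.sum_mem fun i _ => S.smul_mem _ (h _))

lemma polyCoeff_map (m : ℕ) (f : ZMod p → A) (φ : A →ₗ[ZMod p] A') :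
    polyCoeff m (fun t => φ (f t)) = φ (polyCoeff m f) := by
  simp [polyCoeff_apply]

/-- The sum is geometric with ratio 2^(j - m). The ratio is a (p - 1)-th root of unity, so the sum
is 0 unless the ratio is 1, that is j = m; then it is p - 1 = -1, which explains the sign in
`polyCoeff`. -/
lemma polyCoeff_monomial {k : ℕ} (hp : 2 ^ k < p) (hk : 0 < k) {m j : ℕ} (hm : m ≤ k)
    (hj : j ≤ k) (v : A) :
    polyCoeff m (fun t : ZMod p => t ^ j • v) = if j = m then v else 0 := by
  have key : polyCoeff m (fun t : ZMod p => t ^ j • v) =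
      -((∑ i ∈ range (p - 1), ((2 : ZMod p) ^ j * ((2 : ZMod p) ^ m)⁻¹) ^ i) • v) := by
    rw [polyCoeff_apply, Finset.sum_smul]
    congr 1
    refine Finset.sum_congr rfl fun i _ => ?_
    rw [smul_smul]
    congr 1
    rw [mul_pow, inv_pow, ← pow_mul, ← pow_mul, ← pow_mul, ← pow_mul, mul_comm i m, mul_comm i j,
      mul_comm]
  rw [key]
  have h2m := two_pow_ne_zero_of_lt hp hk m
  have h2j := two_pow_ne_zero_of_lt hp hk j
  split_ifs with h
  · subst h
    rw [mul_inv_cancel₀ h2m]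
    have : 1 ≤ p := (Fact.out : p.Prime).one_le
    simp [Nat.cast_sub this]
  · have hne : (2 : ZMod p) ^ j * ((2 : ZMod p) ^ m)⁻¹ ≠ 1 := by
      intro h1
      exact h (two_pow_injOn hp hj hm ((mul_inv_eq_one₀ h2m).1 h1))
    rw [geom_sum_eq hne, ZMod.pow_card_sub_one_eq_one (mul_ne_zero h2j (inv_ne_zero h2m))]
    simp

lemma polyCoeff_sum {k : ℕ} (hp : 2 ^ k < p) {m : ℕ} (hk : 0 < k) (hm : m ≤ k) (v : ℕ → A) :
    polyCoeff m (fun t : ZMod p => ∑ i ∈ range k, t ^ i • v i) = if m < k then v m else 0 := by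
  have : (fun t : ZMod p => ∑ i ∈ range k, t ^ i • v i) =
      ∑ i ∈ range k, fun t : ZMod p => t ^ i • v i := by
    ext t; simp
  rw [this, map_sum, Finset.sum_congr rfl fun i hi =>
    polyCoeff_monomial hp hk hm (Finset.mem_range.1 hi).le (v i)]
  simp

/-- The Euler operator `t d/dt` on polynomial functions of degree less than `k`. -/
def euler (k : ℕ) : (ZMod p → A) →ₗ[ZMod p] (ZMod p → A) :=
  LinearMap.pi fun t => ∑ m ∈ range k, ((m : ZMod p) * t ^ m) • polyCoeff m

lemma euler_apply (k : ℕ) (f : ZMod p → A) (t : ZMod p) :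
    euler k f t = ∑ m ∈ range k, ((m : ZMod p) * t ^ m) • polyCoeff m f := by
  simp [euler]

lemma euler_monomial {k : ℕ} (hp : 2 ^ k < p) {j : ℕ} (hj : j < k) (v : A) :
    euler k (fun t : ZMod p => t ^ j • v) = fun t => ((j : ZMod p) * t ^ j) • v := by
  ext t
  rw [euler_apply, Finset.sum_congr rfl fun m hm => by
    rw [polyCoeff_monomial hp (by omega) (Finset.mem_range.1 hm).le hj.le]]
  simp [hj]

lemma euler_map (k : ℕ) (f : ZMod p → A) (φ : A →ₗ[ZMod p] A') (t : ZMod p) :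
    euler k (fun t => φ (f t)) t = φ (euler k f t) := by
  simp [euler_apply, polyCoeff_map]

/-- Polynomial functions of degree less than `k` whose coefficient of `t ^ i` lies in `C i`. -/
def polyFun (C : ℕ → Submodule (ZMod p) A) (k : ℕ) : Submodule (ZMod p) (ZMod p → A) :=
  Submodule.span (ZMod p) {f | ∃ i < k, ∃ v ∈ C i, f = fun t => t ^ i • v}

variable {C : ℕ → Submodule (ZMod p) A} {C' : ℕ → Submodule (ZMod p) A'}
  {C'' : ℕ → Submodule (ZMod p) A''} {k : ℕ}

lemma monomial_mem_polyFun {i : ℕ} (hi : i < k) {v : A} (hv : v ∈ C i) :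
    (fun t : ZMod p => t ^ i • v) ∈ polyFun C k :=
  Submodule.subset_span ⟨i, hi, v, hv, rfl⟩

lemma const_mem_polyFun (hk : 0 < k) {v : A} (hv : v ∈ C 0) :
    (fun _ : ZMod p => v) ∈ polyFun C k := by
  simpa using monomial_mem_polyFun hk hv

lemma apply_mem_of_mem_polyFun {S : Submodule (ZMod p) A} (hC : ∀ i < k, C i ≤ S)
    {f : ZMod p → A} (hf : f ∈ polyFun C k) (t : ZMod p) : f t ∈ S := by
  induction hf using Submodule.span_induction with
  | mem f h => obtain ⟨i, hi, v, hv, rfl⟩ := h; exact S.smul_mem _ (hC i hi hv)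
  | zero => exact S.zero_mem
  | add f g _ _ h1 h2 => exact S.add_mem h1 h2
  | smul a f _ h => exact S.smul_mem _ h

lemma eq_sum_polyCoeff (hp : 2 ^ k < p) {f : ZMod p → A} (hf : f ∈ polyFun C k) (t : ZMod p) :
    f t = ∑ m ∈ range k, t ^ m • polyCoeff m f := by
  induction hf using Submodule.span_induction with
  | mem f h =>
    obtain ⟨i, hi, v, hv, rfl⟩ := h
    rw [Finset.sum_congr rfl fun m hm => by
      rw [polyCoeff_monomial hp (by omega) (Finset.mem_range.1 hm).le hi.le]]
    simp [hi]
  | zero => simp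
  | add f g _ _ h1 h2 => simp [h1, h2, Finset.sum_add_distrib]
  | smul a f _ h => simp [h, Finset.smul_sum, smul_comm a]

lemma polyCoeff_zero_eq (hp : 2 ^ k < p) (hk : 0 < k) {f : ZMod p → A}
    (hf : f ∈ polyFun C k) : polyCoeff 0 f = f 0 := by
  rw [eq_sum_polyCoeff hp hf 0, Finset.sum_eq_single 0]
  · simp
  · intro m _ hm; simp [hm]
  · intro h; exact absurd (Finset.mem_range.2 hk) h

/-- The coefficient of t^m is multiplied by m, which is invertible for 0 < m < k < p, so only the
constant term survives. All uniqueness statements for differential equations below reduce to this.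
-/
lemma apply_one_eq_of_euler_eq_zero (hp : 2 ^ k < p) (hk : 0 < k) {f : ZMod p → A}
    (hf : f ∈ polyFun C k) (h : euler k f = 0) : f 1 = f 0 := by
  have hc : ∀ m < k, m ≠ 0 → polyCoeff m f = 0 := by
    intro m hm hm0
    have h1 := polyCoeff_sum hp hk hm.le fun i => (i : ZMod p) • polyCoeff i f
    have h2 : (fun t : ZMod p => ∑ i ∈ range k, t ^ i • (i : ZMod p) • polyCoeff i f) =
        euler k f := by
      ext t
      rw [euler_apply]
      exact Finset.sum_congr rfl fun i _ => by rw [smul_smul, mul_comm]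
    rw [h2, h, map_zero, if_pos hm] at h1
    have hlt : k < 2 ^ k := Nat.lt_two_pow_self
    exact (smul_eq_zero.1 h1.symm).resolve_left
      (natCast_ne_zero_of_lt (Nat.pos_of_ne_zero hm0) (by omega))
  rw [← polyCoeff_zero_eq hp hk hf, eq_sum_polyCoeff hp hf 1, Finset.sum_eq_single 0]
  · simp
  · intro m hm hm0; simp [hc m (Finset.mem_range.1 hm) hm0]
  · intro h; exact absurd (Finset.mem_range.2 hk) h

section Bilinear

variable {β : A →ₗ[ZMod p] A' →ₗ[ZMod p] A''}

lemma map₂_eq_zero_of_le (hβ : ∀ i j a b, a ∈ C i → b ∈ C' j → β a b ∈ C'' (i + j))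
    (anti : Antitone C'') (bot : C'' k = ⊥) {i j : ℕ} {a : A} {b : A'} (ha : a ∈ C i)
    (hb : b ∈ C' j) (hij : k ≤ i + j) : β a b = 0 := by
  have := anti hij (hβ i j a b ha hb)
  rwa [bot, Submodule.mem_bot] at this

/-- Bilinearity reduces a property of two polynomial functions to monomials; with `S = ⊥` it proves
identities. -/
lemma apply₂_mem_of_mem_polyFun {N : Type*} [AddCommGroup N] [Module (ZMod p) N]
    (Φ : (ZMod p → A) →ₗ[ZMod p] (ZMod p → A') →ₗ[ZMod p] N) (S : Submodule (ZMod p) N)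
    (h : ∀ i < k, ∀ j < k, ∀ v ∈ C i, ∀ w ∈ C' j,
      Φ (fun t => t ^ i • v) (fun t => t ^ j • w) ∈ S)
    {f : ZMod p → A} {g : ZMod p → A'} (hf : f ∈ polyFun C k) (hg : g ∈ polyFun C' k) :
    Φ f g ∈ S := by
  have h1 : polyFun C' k ≤ (S.comap (Φ f)) := by
    refine Submodule.span_le.2 ?_
    rintro _ ⟨j, hj, w, hw, rfl⟩
    have h2 : polyFun C k ≤ S.comap (Φ.flip fun t => t ^ j • w) := by
      refine Submodule.span_le.2 ?_
      rintro _ ⟨i, hi, v, hv, rfl⟩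
      exact h i hi j hj v hv w hw
    exact h2 hf
  exact h1 hg

variable (β) in
/-- The pointwise extension of a bilinear map to functions. -/
def pointwiseMap₂ : (ZMod p → A) →ₗ[ZMod p] (ZMod p → A') →ₗ[ZMod p] (ZMod p → A'') :=
  LinearMap.mk₂ (ZMod p) (fun f g t => β (f t) (g t))
    (fun f f' g => by ext t; simp) (fun a f g => by ext t; simp)
    (fun f g g' => by ext t; simp) (fun a f g => by ext t; simp)

lemma pointwiseMap₂_apply (f : ZMod p → A) (g : ZMod p → A') :
    pointwiseMap₂ β f g = fun t => β (f t) (g t) := rfl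

lemma pointwiseMap₂_monomial (i j : ℕ) (v : A) (w : A') :
    pointwiseMap₂ β (fun t => t ^ i • v) (fun t => t ^ j • w) =
      fun t => t ^ (i + j) • β v w := by
  ext t
  simp only [pointwiseMap₂_apply, map_smul, LinearMap.smul_apply, smul_smul, pow_add]
  rw [mul_comm]

/-- Terms of degree at least k have coefficients in step k of the filtration, which is 0. This is
why no truncation of products is needed. -/
lemma map₂_mem_polyFun (hβ : ∀ i j a b, a ∈ C i → b ∈ C' j → β a b ∈ C'' (i + j))
    (anti : Antitone C'') (bot : C'' k = ⊥) {f : ZMod p → A} {g : ZMod p → A'}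
    (hf : f ∈ polyFun C k) (hg : g ∈ polyFun C' k) :
    (fun t => β (f t) (g t)) ∈ polyFun C'' k := by
  refine apply₂_mem_of_mem_polyFun (pointwiseMap₂ β) _ ?_ hf hg
  intro i _ j _ v hv w hw
  rw [pointwiseMap₂_monomial]
  by_cases hij : i + j < k
  · exact monomial_mem_polyFun hij (hβ i j v w hv hw)
  · rw [map₂_eq_zero_of_le hβ anti bot hv hw (by omega)]
    simp only [smul_zero]
    exact zero_mem _

lemma euler_map₂ (hp : 2 ^ k < p) (hβ : ∀ i j a b, a ∈ C i → b ∈ C' j → β a b ∈ C'' (i + j))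
    (anti : Antitone C'') (bot : C'' k = ⊥) {f : ZMod p → A} {g : ZMod p → A'}
    (hf : f ∈ polyFun C k) (hg : g ∈ polyFun C' k) :
    euler k (fun t => β (f t) (g t)) =
      (fun t => β (euler k f t) (g t)) + fun t => β (f t) (euler k g t) := by
  have := apply₂_mem_of_mem_polyFun ((pointwiseMap₂ β).compr₂ (euler k) -
    ((pointwiseMap₂ β).comp (euler k) + (pointwiseMap₂ β).compl₂ (euler k))) ⊥ ?_ hf hg
  · exact sub_eq_zero.1 ((Submodule.mem_bot _).1 this)
  intro i hi j hj v hv w hw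
  rw [Submodule.mem_bot]
  simp only [LinearMap.sub_apply, LinearMap.compr₂_apply, LinearMap.add_apply,
    LinearMap.comp_apply, LinearMap.compl₂_apply, pointwiseMap₂_monomial,
    euler_monomial hp hi, euler_monomial hp hj, sub_eq_zero]
  by_cases hij : i + j < k
  · rw [euler_monomial hp hij]
    ext t
    simp only [pointwiseMap₂_apply, Pi.add_apply, map_smul, LinearMap.smul_apply, smul_smul,
      ← add_smul]
    congr 1
    push_cast
    ring
  · have h0 := map₂_eq_zero_of_le hβ anti bot hv hw (by omega)
    ext t
    simp only [pointwiseMap₂_apply, Pi.add_apply, map_smul, LinearMap.smul_apply, h0, smul_zero,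
      add_zero]
    exact congrFun (map_zero (euler k)) t

lemma polyCoeff_one_map₂ (hp : 2 ^ k < p) (hk : 0 < k)
    (hβ : ∀ i j a b, a ∈ C i → b ∈ C' j → β a b ∈ C'' (i + j))
    (anti : Antitone C'') (bot : C'' k = ⊥) {f : ZMod p → A} {g : ZMod p → A'}
    (hf : f ∈ polyFun C k) (hg : g ∈ polyFun C' k) :
    polyCoeff 1 (fun t => β (f t) (g t)) =
      β (polyCoeff 1 f) (g 0) + β (f 0) (polyCoeff 1 g) := by
  rw [← polyCoeff_zero_eq hp hk hf, ← polyCoeff_zero_eq hp hk hg]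
  have := apply₂_mem_of_mem_polyFun ((pointwiseMap₂ β).compr₂ (polyCoeff 1) -
    (β.compl₁₂ (polyCoeff 1) (polyCoeff 0) + β.compl₁₂ (polyCoeff 0) (polyCoeff 1))) ⊥ ?_ hf hg
  · exact sub_eq_zero.1 ((Submodule.mem_bot _).1 this)
  intro i hi j hj v hv w hw
  rw [Submodule.mem_bot]
  simp only [LinearMap.sub_apply, LinearMap.compr₂_apply, LinearMap.add_apply,
    LinearMap.compl₁₂_apply, pointwiseMap₂_monomial, sub_eq_zero,
    polyCoeff_monomial hp hk hk hi.le, polyCoeff_monomial hp hk hk hj.le,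
    polyCoeff_monomial hp hk hk.le hi.le, polyCoeff_monomial hp hk hk.le hj.le]
  by_cases hij : i + j ≤ k
  · rw [polyCoeff_monomial hp hk hk hij]
    rcases i with _ | _ | i <;> rcases j with _ | _ | j <;> (simp; try omega)
  · have h0 := map₂_eq_zero_of_le hβ anti bot hv hw (by omega)
    simp only [h0, smul_zero]
    have : (fun t : ZMod p => (0 : A'')) = 0 := rfl
    rw [this, map_zero]
    split_ifs <;> simp [h0]

end Bilinear

end PolynomialFunctions

/-! ### Exponentials in nilpotently filtered associative algebras. -/

section TruncatedExponential

variable {p : ℕ} [Fact p.Prime] {R : Type*} [Ring R] [Algebra (ZMod p) R]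

/-- A decreasing multiplicative filtration of an algebra which vanishes from step `k` on. -/
structure IsAlgFiltration (G : ℕ → Submodule (ZMod p) R) (k : ℕ) : Prop where
  anti : Antitone G
  one_mem : 1 ∈ G 0
  mul_mem : ∀ i j a b, a ∈ G i → b ∈ G j → a * b ∈ G (i + j)
  bot : G k = ⊥

/-- The exponential series truncated after the terms of degree less than `k`. -/
def truncExp (p : ℕ) [Fact p.Prime] {R : Type*} [Ring R] [Algebra (ZMod p) R] (k : ℕ) (x : R) : R :=
  ∑ n ∈ range k, (n.factorial : ZMod p)⁻¹ • x ^ n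

lemma truncExp_zero {k : ℕ} (hk : 0 < k) : truncExp p k (0 : R) = 1 := by
  rw [truncExp, Finset.sum_eq_single 0]
  · simp
  · intro n _ hn; simp [hn]
  · intro h; exact absurd (Finset.mem_range.2 hk) h

lemma truncExp_pi_apply (k : ℕ) (X : ZMod p → R) (t : ZMod p) :
    truncExp p k X t = truncExp p k (X t) := by
  simp [truncExp]

variable {G : ℕ → Submodule (ZMod p) R} {k : ℕ}

namespace IsAlgFiltration

variable (hG : IsAlgFiltration G k)
include hG

lemma eq_zero {n : ℕ} (hn : k ≤ n) {x : R} (hx : x ∈ G n) : x = 0 := by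
  have := hG.anti hn hx
  rwa [hG.bot, Submodule.mem_bot] at this

lemma pow_mem {x : R} (hx : x ∈ G 1) (n : ℕ) : x ^ n ∈ G n := by
  induction n with
  | zero => simpa using hG.one_mem
  | succ n ih => rw [pow_succ]; exact hG.mul_mem _ _ _ _ ih hx

lemma one_mem_polyFun (hk : 0 < k) : (1 : ZMod p → R) ∈ polyFun G k :=
  const_mem_polyFun hk hG.one_mem

lemma mul_mem_polyFun {f g : ZMod p → R} (hf : f ∈ polyFun G k) (hg : g ∈ polyFun G k) :
    f * g ∈ polyFun G k :=
  map₂_mem_polyFun (β := LinearMap.mul (ZMod p) R) (fun i j a b => hG.mul_mem i j a b)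
    hG.anti hG.bot hf hg

lemma pow_mem_polyFun (hk : 0 < k) {f : ZMod p → R} (hf : f ∈ polyFun G k) (n : ℕ) :
    f ^ n ∈ polyFun G k := by
  induction n with
  | zero => simpa using hG.one_mem_polyFun hk
  | succ n ih => rw [pow_succ]; exact hG.mul_mem_polyFun ih hf

lemma truncExp_mem_polyFun (hk : 0 < k) {f : ZMod p → R} (hf : f ∈ polyFun G k) :
    truncExp p k f ∈ polyFun G k :=
  Submodule.sum_mem _ fun n _ => Submodule.smul_mem _ _ (hG.pow_mem_polyFun hk hf n)

lemma euler_mul (hp : 2 ^ k < p) {f g : ZMod p → R} (hf : f ∈ polyFun G k)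
    (hg : g ∈ polyFun G k) : euler k (f * g) = euler k f * g + f * euler k g :=
  euler_map₂ (β := LinearMap.mul (ZMod p) R) hp (fun i j a b => hG.mul_mem i j a b)
    hG.anti hG.bot hf hg

omit hG in
lemma _root_.euler_one (hp : 2 ^ k < p) (hk : 0 < k) : euler k (1 : ZMod p → R) = 0 := by
  have h := euler_monomial hp hk (1 : R)
  have e : (fun t : ZMod p => t ^ 0 • (1 : R)) = 1 := by ext; simp
  rw [e] at h
  rw [h]
  ext; simp

/-- With D = t d/dt and w_l = ad(X)^l (D X), this is the degree n + 1 part of the formula D(exp X) =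
(∑ w_l / (l + 1)!) exp X. The recursion for `w` is stated as a hypothesis so that `w` may be
supplied in any convenient form. -/
lemma euler_pow_div_factorial (hp : 2 ^ k < p) (hk : 0 < k) {X : ZMod p → R}
    (hX : X ∈ polyFun G k) {w : ℕ → ZMod p → R} (h0 : w 0 = euler k X)
    (hw : ∀ l, X * w l = w (l + 1) + w l * X) (n : ℕ) (hn : n + 1 < p) :
    euler k (((n + 1).factorial : ZMod p)⁻¹ • X ^ (n + 1)) =
      ∑ x ∈ antidiagonal n, (((x.1 + 1).factorial : ZMod p)⁻¹ • w x.1) *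
        ((x.2.factorial : ZMod p)⁻¹ • X ^ x.2) := by
  induction n with
  | zero => simp [h0]
  | succ n ih =>
    have ne : ∀ m, 0 < m → m < p → (m : ZMod p) ≠ 0 := fun m h h' => natCast_ne_zero_of_lt h h'
    have hfac : ∀ m : ℕ, m + 1 < p → ((m + 1 : ℕ) : ZMod p) * ((m + 1).factorial : ZMod p)⁻¹ =
        (m.factorial : ZMod p)⁻¹ := by
      intro m hm
      rw [Nat.factorial_succ, Nat.cast_mul, mul_inv, mul_inv_cancel_left₀ (ne _ (by omega) hm)]
    set e : ℕ → ZMod p → R := fun m => (m.factorial : ZMod p)⁻¹ • X ^ m with he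
    set u : ℕ → ZMod p → R := fun l => ((l + 1).factorial : ZMod p)⁻¹ • w l with hu
    have hXe : ∀ m, m + 1 < p → X * e m = ((m + 1 : ℕ) : ZMod p) • e (m + 1) := by
      intro m hm
      simp only [he]
      rw [smul_smul, hfac m hm, mul_smul_comm, ← pow_succ']
    have hXu : ∀ l, l + 2 < p → X * u l = ((l + 2 : ℕ) : ZMod p) • u (l + 1) + u l * X := by
      intro l hl
      simp only [hu]
      rw [mul_smul_comm, hw, smul_add, smul_smul, hfac (l + 1) hl, smul_mul_assoc]
    -- Apply the Leibniz rule to X · X^(n+1)/(n+1)! and move X to the right through each w_l. The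
    -- contributions l + 1 from `u` and m from `e` add up to n + 2, which is invertible and is
    -- cancelled at the end.
    have key : ((n + 2 : ℕ) : ZMod p) • euler k (e (n + 2)) =
        ((n + 2 : ℕ) : ZMod p) • ∑ x ∈ antidiagonal (n + 1), u x.1 * e x.2 := by
      rw [← map_smul, ← hXe (n + 1) hn, hG.euler_mul hp hX
        (Submodule.smul_mem _ _ (hG.pow_mem_polyFun hk hX _)), ← h0]
      have ih' : euler k (e (n + 1)) = ∑ x ∈ antidiagonal n, u x.1 * e x.2 := ih (by omega)
      rw [ih', Finset.mul_sum, Finset.smul_sum]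
      have h1 : ∑ x ∈ antidiagonal n, X * (u x.1 * e x.2) =
          ∑ x ∈ antidiagonal n, ((x.1 + 2 : ℕ) : ZMod p) • (u (x.1 + 1) * e x.2) +
          ∑ x ∈ antidiagonal n, ((x.2 + 1 : ℕ) : ZMod p) • (u x.1 * e (x.2 + 1)) := by
        rw [← Finset.sum_add_distrib]
        refine Finset.sum_congr rfl fun x hx => ?_
        have hx' := Finset.HasAntidiagonal.mem_antidiagonal.1 hx
        rw [← mul_assoc, hXu _ (by omega), add_mul, smul_mul_assoc, mul_assoc,
          hXe _ (by omega), mul_smul_comm _ (u x.1) (e (x.2 + 1))]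
      have h2 : ∑ x ∈ antidiagonal (n + 1), ((n + 2 : ℕ) : ZMod p) • (u x.1 * e x.2) =
          ∑ x ∈ antidiagonal (n + 1), ((x.1 + 1 : ℕ) : ZMod p) • (u x.1 * e x.2) +
          ∑ x ∈ antidiagonal (n + 1), ((x.2 : ℕ) : ZMod p) • (u x.1 * e x.2) := by
        rw [← Finset.sum_add_distrib]
        refine Finset.sum_congr rfl fun x hx => ?_
        have hx' := Finset.HasAntidiagonal.mem_antidiagonal.1 hx
        rw [← add_smul, ← Nat.cast_add, show n + 2 = x.1 + 1 + x.2 by omega]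
      have hu0 : w 0 = u 0 := by simp [hu]
      rw [h1, h2, Finset.Nat.sum_antidiagonal_succ, Finset.Nat.sum_antidiagonal_succ', hu0]
      simp only [Nat.cast_zero, zero_smul, zero_add, Nat.cast_one, one_smul, add_assoc,
        Nat.reduceAdd]
      rfl
    exact smul_right_injective _ (ne (n + 2) (by omega) hn) key

lemma euler_truncExp (hp : 2 ^ k < p) (hk : 0 < k) {X : ZMod p → R}
    (hX : X ∈ polyFun G k) {w : ℕ → ZMod p → R} (h0 : w 0 = euler k X)
    (hw : ∀ l, X * w l = w (l + 1) + w l * X)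
    (hv : ∀ l m, k ≤ l + 1 + m → w l * X ^ m = 0) :
    euler k (truncExp p k X) =
      (∑ l ∈ range k, ((l + 1).factorial : ZMod p)⁻¹ • w l) * truncExp p k X := by
  obtain ⟨k, rfl⟩ : ∃ k', k = k' + 1 := ⟨k - 1, by omega⟩
  have hlt : k + 1 < 2 ^ (k + 1) := Nat.lt_two_pow_self
  rw [truncExp, map_sum, Finset.sum_range_succ', pow_zero, map_smul, euler_one hp hk, smul_zero,
    add_zero, Finset.sum_congr rfl fun n hn => hG.euler_pow_div_factorial hp hk hX h0 hw n
      (by have := Finset.mem_range.1 hn; omega), Finset.sum_mul_sum, ← Finset.sum_product',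
    -- The product of the two truncated sums runs over a square; the part outside the triangle
    -- vanishes by `hv`.
    ← Finset.sum_filter_add_sum_filter_not (range (k + 1) ×ˢ range (k + 1))
      fun x => x.1 + x.2 < k]
  rw [Finset.sum_eq_zero (s := filter (fun x => ¬ _) _), add_zero]
  · rw [← Finset.sum_fiberwise_of_maps_to (s := filter _ _) (t := range k) (g := fun x => x.1 + x.2)]
    · refine Finset.sum_congr rfl fun n hn => Finset.sum_congr ?_ fun _ _ => rfl
      ext x
      simp only [Finset.HasAntidiagonal.mem_antidiagonal, Finset.mem_filter, Finset.mem_product, Finset.mem_range]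
        at hn ⊢
      omega
    · intro x hx
      exact Finset.mem_range.2 (Finset.mem_filter.1 hx).2
  · intro x hx
    have := (Finset.mem_filter.1 hx).2
    rw [smul_mul_smul_comm, hv _ _ (by omega), smul_zero]

lemma linear_mem_polyFun {x : R} (hx : x ∈ G 1) : (fun t : ZMod p => t • x) ∈ polyFun G k := by
  by_cases hk : 1 < k
  · simpa using monomial_mem_polyFun hk hx
  · have : x = 0 := hG.eq_zero (by omega) hx
    simp only [this, smul_zero]
    exact zero_mem _

lemma euler_linear (hp : 2 ^ k < p) {x : R} (hx : x ∈ G 1) :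
    euler k (fun t : ZMod p => t • x) = fun t => t • x := by
  by_cases hk : 1 < k
  · simpa using euler_monomial hp hk x
  · have : x = 0 := hG.eq_zero (by omega) hx
    simp only [this, smul_zero]
    exact map_zero _

lemma truncExp_linear_mem (hk : 0 < k) {x : R} (hx : x ∈ G 1) :
    (fun t : ZMod p => truncExp p k (t • x)) ∈ polyFun G k := by
  convert hG.truncExp_mem_polyFun hk (hG.linear_mem_polyFun hx) using 1
  ext t
  rw [truncExp_pi_apply]

lemma euler_truncExp_linear (hp : 2 ^ k < p) (hk : 0 < k) {x : R} (hx : x ∈ G 1) :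
    euler k (fun t : ZMod p => truncExp p k (t • x)) =
      (fun t : ZMod p => t • x) * fun t => truncExp p k (t • x) := by
  have e : (fun t : ZMod p => truncExp p k (t • x)) = truncExp p k (fun t : ZMod p => t • x) := by
    ext t; rw [truncExp_pi_apply]
  rw [e, hG.euler_truncExp hp hk (hG.linear_mem_polyFun hx)
    (w := fun l => if l = 0 then fun t : ZMod p => t • x else 0)]
  · congr 1
    rw [Finset.sum_eq_single 0]
    · simp
    · intro l _ hl; simp [hl]
    · intro h; exact absurd (Finset.mem_range.2 hk) h
  · rw [if_pos rfl, hG.euler_linear hp hx]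
  · intro l
    by_cases hl : l = 0 <;> simp [hl]
  · intro l m hlm
    by_cases hl : l = 0
    · subst hl
      ext t
      rw [if_pos rfl, ← pow_succ', Pi.pow_apply, smul_pow,
        hG.eq_zero (by omega) (hG.pow_mem hx (m + 1))]
      simp
    · simp [hl]

omit hG in
lemma commute_truncExp {x y : R} (h : Commute x y) : Commute x (truncExp p k y) :=
  Commute.sum_right _ _ _ fun n _ => (h.pow_right n).smul_right _

/-- The curve exp(tx) exp(-tx) has derivative zero, so its values at 1 and 0 agree. -/
lemma truncExp_mul_truncExp_neg (hp : 2 ^ k < p) (hk : 0 < k) {x : R} (hx : x ∈ G 1) :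
    truncExp p k x * truncExp p k (-x) = 1 := by
  have hx' : -x ∈ G 1 := Submodule.neg_mem _ hx
  have h := apply_one_eq_of_euler_eq_zero hp hk
    (hG.mul_mem_polyFun (hG.truncExp_linear_mem hk hx) (hG.truncExp_linear_mem hk hx')) ?_
  · simpa [truncExp_zero hk] using h
  · rw [hG.euler_mul hp (hG.truncExp_linear_mem hk hx) (hG.truncExp_linear_mem hk hx'),
      hG.euler_truncExp_linear hp hk hx, hG.euler_truncExp_linear hp hk hx']
    ext t
    have hc : Commute (t • x) (truncExp p k (t • x)) := commute_truncExp (Commute.refl _)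
    simp only [Pi.add_apply, Pi.mul_apply, smul_neg, Pi.zero_apply]
    rw [hc.eq, mul_assoc, ← mul_add, neg_mul, add_neg_cancel, mul_zero]

/-- Uniqueness of solutions of `t M' = t x M`. -/
lemma apply_one_eq_of_euler_eq (hp : 2 ^ k < p) (hk : 0 < k) {x : R} (hx : x ∈ G 1)
    {M : ZMod p → R} (hM : M ∈ polyFun G k)
    (h : euler k M = (fun t : ZMod p => t • x) * M) : M 1 = truncExp p k x * M 0 := by
  have hx' : -x ∈ G 1 := Submodule.neg_mem _ hx
  have h1 := apply_one_eq_of_euler_eq_zero hp hk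
    (hG.mul_mem_polyFun (hG.truncExp_linear_mem hk hx') hM) ?_
  · simp only [Pi.mul_apply, zero_smul, one_smul, truncExp_zero hk, one_mul] at h1
    rw [← h1, ← mul_assoc, hG.truncExp_mul_truncExp_neg hp hk hx, one_mul]
  · rw [hG.euler_mul hp (hG.truncExp_linear_mem hk hx') hM,
      hG.euler_truncExp_linear hp hk hx', h]
    ext t
    have hc : Commute (t • -x) (truncExp p k (t • -x)) := commute_truncExp (Commute.refl _)
    simp only [Pi.add_apply, Pi.mul_apply, Pi.zero_apply]
    rw [hc.eq, mul_assoc, ← mul_add, smul_neg, neg_mul, neg_add_cancel, mul_zero]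

/-- Since x and y commute, exp(tx) exp(ty) solves t M' = t (x + y) M with M(0) = 1. -/
lemma truncExp_add (hp : 2 ^ k < p) (hk : 0 < k) {x y : R} (hx : x ∈ G 1) (hy : y ∈ G 1)
    (h : Commute x y) : truncExp p k (x + y) = truncExp p k x * truncExp p k y := by
  have h1 := hG.apply_one_eq_of_euler_eq hp hk (Submodule.add_mem _ hx hy)
    (hG.mul_mem_polyFun (hG.truncExp_linear_mem hk hx) (hG.truncExp_linear_mem hk hy)) ?_
  · simpa [truncExp_zero hk] using h1.symm
  · rw [hG.euler_mul hp (hG.truncExp_linear_mem hk hx) (hG.truncExp_linear_mem hk hy),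
      hG.euler_truncExp_linear hp hk hx, hG.euler_truncExp_linear hp hk hy]
    ext t
    have hc : Commute (t • y) (truncExp p k (t • x)) :=
      commute_truncExp ((h.symm.smul_left _).smul_right _)
    simp only [Pi.add_apply, Pi.mul_apply]
    rw [smul_add, add_mul, mul_assoc, ← mul_assoc (truncExp p k (t • x)), ← hc.eq, mul_assoc]

lemma truncExp_nsmul (hp : 2 ^ k < p) (hk : 0 < k) {x : R} (hx : x ∈ G 1) (n : ℕ) :
    truncExp p k (n • x) = truncExp p k x ^ n := by
  induction n with
  | zero => simp [truncExp_zero hk]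
  | succ n ih =>
    rw [succ_nsmul, pow_succ, ← ih]
    exact hG.truncExp_add hp hk (Submodule.smul_of_tower_mem _ n hx) hx
      ((Commute.refl x).smul_left n)

end IsAlgFiltration

end TruncatedExponential

/-! ### Inverting perturbations of the identity along a filtration. -/

section Contraction

variable {p : ℕ} [Fact p.Prime] {A : Type*} [AddCommGroup A] [Module (ZMod p) A]

/-- The map `g` preserves the first step of the filtration `C` and improves congruences there by
one step. -/
structure IsContracting (C : ℕ → Submodule (ZMod p) A) (g : A → A) : Prop where
  mem : ∀ x ∈ C 1, g x ∈ C 1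
  sub_mem : ∀ n, 1 ≤ n → ∀ x ∈ C 1, ∀ y ∈ C 1, x - y ∈ C n → g x - g y ∈ C (n + 1)

variable {C : ℕ → Submodule (ZMod p) A} {k : ℕ} {g : A → A}

lemma IsContracting.sub_mem_of_add_sub_add_mem (hg : IsContracting C g) (anti : Antitone C)
    {x y : A} (hx : x ∈ C 1) (hy : y ∈ C 1) {n : ℕ}
    (h : (x + g x) - (y + g y) ∈ C n) : x - y ∈ C n := by
  have key : ∀ m, m + 1 ≤ n → x - y ∈ C (m + 1) := by
    intro m
    induction m with
    | zero => exact fun _ => Submodule.sub_mem _ hx hy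
    | succ m ih =>
      intro hm
      have h1 := hg.sub_mem (m + 1) (by omega) x hx y hy (ih (by omega))
      have e : x - y = ((x + g x) - (y + g y)) - (g x - g y) := by abel
      rw [e]
      exact Submodule.sub_mem _ (anti hm h) h1
  rcases n with _ | n
  · exact anti (Nat.zero_le 1) (Submodule.sub_mem _ hx hy)
  · exact key n le_rfl

lemma IsContracting.iterate_mem (hg : IsContracting C g) {c : A} (hc : c ∈ C 1) (m : ℕ) :
    (fun z => c - g z)^[m] 0 ∈ C 1 := by
  induction m with
  | zero => exact Submodule.zero_mem _
  | succ m ih =>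
    rw [Function.iterate_succ_apply']
    exact Submodule.sub_mem _ hc (hg.mem _ ih)

lemma IsContracting.iterate_succ_sub_mem (hg : IsContracting C g) {c : A} (hc : c ∈ C 1)
    (m : ℕ) :
    (fun z => c - g z)^[m + 1] 0 - (fun z => c - g z)^[m] 0 ∈ C (m + 1) := by
  induction m with
  | zero => simpa using Submodule.sub_mem _ hc (hg.mem 0 (Submodule.zero_mem _))
  | succ m ih =>
    have h := hg.sub_mem (m + 1) (by omega) _ (hg.iterate_mem hc (m + 1)) _
      (hg.iterate_mem hc m) ih
    rw [Function.iterate_succ_apply' _ (m + 1)]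
    nth_rw 2 [Function.iterate_succ_apply']
    rw [sub_sub_sub_cancel_left]
    simpa using Submodule.neg_mem _ h

/-- Successive iterates of z ↦ c - g z agree modulo ever deeper steps of the filtration, so after k
iterations a fixed point is reached. -/
lemma IsContracting.iterate_add (hg : IsContracting C g) (anti : Antitone C) (bot : C k = ⊥)
    {c : A} (hc : c ∈ C 1) :
    (fun z => c - g z)^[k] 0 + g ((fun z => c - g z)^[k] 0) = c := by
  have h := anti (Nat.le_succ k) (hg.iterate_succ_sub_mem hc k)
  rw [bot, Submodule.mem_bot, sub_eq_zero, Function.iterate_succ_apply'] at h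
  nth_rw 1 [← h]
  simp

end Contraction

/-! ### The series W for a nilpotent nonassociative product, and its inverse. -/

section ExpSeries

variable {p : ℕ} [Fact p.Prime] {A : Type*} [AddCommGroup A] [Module (ZMod p) A]

/-- The truncated series `a + (1/2!) a a + (1/3!) a (a a) + ⋯` for a bilinear product. -/
def expSeries (mul : A →ₗ[ZMod p] A →ₗ[ZMod p] A) (k : ℕ) (a : A) : A :=
  ∑ n ∈ range k, ((n + 1).factorial : ZMod p)⁻¹ • ((mul a) ^ n) a

/-- A decreasing multiplicative filtration of a nonassociative algebra, starting at step `1`, which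
vanishes from step `k` on. -/
structure IsMulFiltration (mul : A →ₗ[ZMod p] A →ₗ[ZMod p] A) (C : ℕ → Submodule (ZMod p) A)
    (k : ℕ) : Prop where
  anti : Antitone C
  mul_mem : ∀ i j a b, a ∈ C i → b ∈ C j → mul a b ∈ C (i + j)
  zero_le : C 0 ≤ C 1
  bot : C k = ⊥

variable {mul : A →ₗ[ZMod p] A →ₗ[ZMod p] A} {C : ℕ → Submodule (ZMod p) A} {k : ℕ}

lemma expSeries_zero : expSeries mul k 0 = 0 := by
  simp [expSeries]

namespace IsMulFiltration

variable (hC : IsMulFiltration mul C k)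
include hC

lemma le_one (i : ℕ) : C i ≤ C 1 := (hC.anti (Nat.zero_le i)).trans hC.zero_le

lemma pow_apply_mem {x y : A} {n : ℕ} (hx : x ∈ C 1) (hy : y ∈ C n) (m : ℕ) :
    ((mul x) ^ m) y ∈ C (n + m) := by
  induction m with
  | zero => simpa using hy
  | succ m ih =>
    rw [pow_succ', Module.End.mul_apply, show n + (m + 1) = 1 + (n + m) by omega]
    exact hC.mul_mem _ _ _ _ hx ih

lemma pow_apply_sub_mem {x y : A} (hx : x ∈ C 1) (hy : y ∈ C 1) {n : ℕ} (h : x - y ∈ C n)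
    (m : ℕ) : ((mul x) ^ m) x - ((mul y) ^ m) y ∈ C (n + m) := by
  induction m with
  | zero => simpa using h
  | succ m ih =>
    have e : ((mul x) ^ (m + 1)) x - ((mul y) ^ (m + 1)) y =
        mul (x - y) (((mul x) ^ m) x) + mul y (((mul x) ^ m) x - ((mul y) ^ m) y) := by
      simp only [pow_succ', Module.End.mul_apply, map_sub, LinearMap.sub_apply]
      abel
    rw [e]
    refine Submodule.add_mem _ ?_ ?_
    · have := hC.mul_mem _ _ _ _ h (hC.pow_apply_mem hx hx m)
      rwa [add_comm 1 m] at this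
    · have := hC.mul_mem _ _ _ _ hy ih
      rwa [show n + (m + 1) = 1 + (n + m) by omega]

lemma expSeries_mem {x : A} {n : ℕ} (hx : x ∈ C n) : expSeries mul k x ∈ C n :=
  Submodule.sum_mem _ fun m _ => Submodule.smul_mem _ _
    (hC.anti (Nat.le_add_right n m) (hC.pow_apply_mem (hC.le_one n hx) hx m))

/-- Every term after the linear one contains a further factor, so it pushes a difference at least
one step deeper. Hence W is a contracting perturbation of the identity. -/
lemma expSeries_sub_sub_mem (hk : 0 < k) {x y : A} (hx : x ∈ C 1) (hy : y ∈ C 1) {n : ℕ}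
    (h : x - y ∈ C n) : (expSeries mul k x - expSeries mul k y) - (x - y) ∈ C (n + 1) := by
  obtain ⟨k, rfl⟩ : ∃ k', k = k' + 1 := ⟨k - 1, by omega⟩
  rw [expSeries, expSeries, Finset.sum_range_succ', Finset.sum_range_succ']
  have e : ∀ u v : A, (u + ((0 + 1).factorial : ZMod p)⁻¹ • (mul x ^ 0) x) -
      (v + ((0 + 1).factorial : ZMod p)⁻¹ • (mul y ^ 0) y) - (x - y) = u - v := by
    intro u v
    simp
    abel
  rw [e, ← Finset.sum_sub_distrib]
  refine Submodule.sum_mem _ fun m _ => ?_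
  rw [← smul_sub]
  exact Submodule.smul_mem _ _ (hC.anti (by omega) (hC.pow_apply_sub_mem hx hy h (m + 1)))

lemma isContracting (hk : 0 < k) : IsContracting C fun x => expSeries mul k x - x where
  mem x hx := Submodule.sub_mem _ (hC.expSeries_mem hx) hx
  sub_mem n _ x hx y hy h := by
    have := hC.expSeries_sub_sub_mem hk hx hy h
    rwa [sub_sub_sub_comm] at this

lemma sub_mem_of_expSeries_sub_mem (hk : 0 < k) {x y : A} (hx : x ∈ C 1) (hy : y ∈ C 1) {n : ℕ}
    (h : expSeries mul k x - expSeries mul k y ∈ C n) : x - y ∈ C n :=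
  (hC.isContracting hk).sub_mem_of_add_sub_add_mem hC.anti hx hy (by simpa using h)

lemma expSeries_injOn (hk : 0 < k) {x y : A} (hx : x ∈ C 1) (hy : y ∈ C 1)
    (h : expSeries mul k x = expSeries mul k y) : x = y := by
  have := hC.sub_mem_of_expSeries_sub_mem hk hx hy (n := k) (by rw [h, sub_self]; exact zero_mem _)
  rwa [hC.bot, Submodule.mem_bot, sub_eq_zero] at this

lemma mem_of_expSeries_mem (hk : 0 < k) {x : A} (hx : x ∈ C 1) {n : ℕ}
    (h : expSeries mul k x ∈ C n) : x ∈ C n := by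
  have := hC.sub_mem_of_expSeries_sub_mem hk hx (zero_mem _) (n := n)
    (by rwa [expSeries_zero, sub_zero])
  rwa [sub_zero] at this

lemma exists_expSeries_eq (hk : 0 < k) {c : A} (hc : c ∈ C 1) :
    ∃ x ∈ C 1, expSeries mul k x = c :=
  ⟨_, (hC.isContracting hk).iterate_mem hc k, by
    simpa using (hC.isContracting hk).iterate_add hC.anti hC.bot hc⟩

lemma mul_mem_polyFun {f g : ZMod p → A} (hf : f ∈ polyFun C k) (hg : g ∈ polyFun C k) :
    (fun t => mul (f t) (g t)) ∈ polyFun C k :=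
  map₂_mem_polyFun hC.mul_mem hC.anti hC.bot hf hg

lemma pow_apply_mem_polyFun {f g : ZMod p → A} (hf : f ∈ polyFun C k) (hg : g ∈ polyFun C k)
    (n : ℕ) : (fun t => ((mul (f t)) ^ n) (g t)) ∈ polyFun C k := by
  induction n with
  | zero => simpa using hg
  | succ n ih =>
    simp only [pow_succ', Module.End.mul_apply]
    exact hC.mul_mem_polyFun hf ih

lemma expSeries_mem_polyFun {f : ZMod p → A} (hf : f ∈ polyFun C k) :
    (fun t => expSeries mul k (f t)) ∈ polyFun C k := by
  have e : (fun t => expSeries mul k (f t)) =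
      ∑ n ∈ range k, ((n + 1).factorial : ZMod p)⁻¹ • fun t => ((mul (f t)) ^ n) (f t) := by
    ext t; simp [expSeries]
  rw [e]
  exact Submodule.sum_mem _ fun n _ => Submodule.smul_mem _ _ (hC.pow_apply_mem_polyFun hf hf n)

lemma apply_mem_one {f : ZMod p → A} (hf : f ∈ polyFun C k) (t : ZMod p) : f t ∈ C 1 :=
  apply_mem_of_mem_polyFun (fun i _ => hC.le_one i) hf t

/-- The inverse of `expSeries` preserves polynomial functions. -/
lemma exists_polyFun_expSeries_eq (hk : 0 < k) {c : ZMod p → A} (hc : c ∈ polyFun C k) :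
    ∃ z ∈ polyFun C k, ∀ t, expSeries mul k (z t) = c t := by
  refine ⟨fun t => (fun z => c t - (expSeries mul k z - z))^[k] 0, ?_, fun t => ?_⟩
  · have key : ∀ m, (fun t => (fun z => c t - (expSeries mul k z - z))^[m] 0) ∈ polyFun C k := by
      intro m
      induction m with
      | zero => exact zero_mem _
      | succ m ih =>
        simp only [Function.iterate_succ_apply']
        exact sub_mem hc (sub_mem (hC.expSeries_mem_polyFun ih) ih)
    exact key k
  · simpa using (hC.isContracting hk).iterate_add hC.anti hC.bot (hC.apply_mem_one hc t)

/-- As z(0) = 0, every factor z(t) is divisible by t, so at least two such factors leave no linear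
term. -/
lemma polyCoeff_one_pow_apply (hp : 2 ^ k < p) (hk : 0 < k) {z f : ZMod p → A}
    (hz : z ∈ polyFun C k) (hf : f ∈ polyFun C k) (hz0 : z 0 = 0) (n : ℕ) :
    polyCoeff 1 (fun t => ((mul (z t)) ^ (n + 2)) (f t)) = 0 := by
  simp only [pow_succ' _ (n + 1), Module.End.mul_apply]
  rw [polyCoeff_one_map₂ hp hk hC.mul_mem hC.anti hC.bot hz (hC.pow_apply_mem_polyFun hz hf _)]
  simp [hz0, pow_succ']

lemma polyCoeff_one_pow_apply_self (hp : 2 ^ k < p) (hk : 0 < k) {z : ZMod p → A}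
    (hz : z ∈ polyFun C k) (hz0 : z 0 = 0) (n : ℕ) :
    polyCoeff 1 (fun t => ((mul (z t)) ^ (n + 1)) (z t)) = 0 := by
  simp only [pow_succ', Module.End.mul_apply]
  rw [polyCoeff_one_map₂ hp hk hC.mul_mem hC.anti hC.bot hz (hC.pow_apply_mem_polyFun hz hz _)]
  rcases n with _ | n <;> simp [hz0, pow_succ']

lemma polyCoeff_one_expSeries (hp : 2 ^ k < p) (hk : 0 < k) {z : ZMod p → A}
    (hz : z ∈ polyFun C k) (hz0 : z 0 = 0) :
    polyCoeff 1 (fun t => expSeries mul k (z t)) = polyCoeff 1 z := by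
  have e : (fun t => expSeries mul k (z t)) =
      ∑ n ∈ range k, ((n + 1).factorial : ZMod p)⁻¹ • fun t => ((mul (z t)) ^ n) (z t) := by
    ext t; simp [expSeries]
  rw [e, map_sum, Finset.sum_eq_single 0]
  · simp
  · intro n _ hn
    obtain ⟨n, rfl⟩ := Nat.exists_eq_succ_of_ne_zero hn
    rw [map_smul, hC.polyCoeff_one_pow_apply_self hp hk hz hz0, smul_zero]
  · intro h; exact absurd (Finset.mem_range.2 hk) h

end IsMulFiltration

namespace IsAlgFiltration

variable {R : Type*} [Ring R] [Algebra (ZMod p) R] {G : ℕ → Submodule (ZMod p) R}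
  (hG : IsAlgFiltration G k)
include hG

/-- Replacing n by max n 1 discards the unit of the algebra, so that the results on W apply to exp -
1 on the nilpotent part. -/
lemma isMulFiltration (hk : 1 ≤ k) :
    IsMulFiltration (LinearMap.mul (ZMod p) R) (fun n => G (max n 1)) k where
  anti i j hij := hG.anti (by omega)
  mul_mem i j a b ha hb := hG.anti (by omega) (hG.mul_mem _ _ _ _ ha hb)
  zero_le := le_rfl
  bot := by rw [max_eq_left hk, hG.bot]

lemma truncExp_eq {x : R} (hx : x ∈ G 1) :
    truncExp p k x = 1 + expSeries (LinearMap.mul (ZMod p) R) k x := by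
  -- `expSeries` reaches degree k while `truncExp` stops at degree k - 1; the extra power vanishes.
  have h : truncExp p k x = truncExp p (k + 1) x := by
    rw [truncExp, truncExp, Finset.sum_range_succ, hG.eq_zero le_rfl (hG.pow_mem hx k), smul_zero,
      add_zero]
  rw [h, truncExp, Finset.sum_range_succ', add_comm, expSeries]
  congr 1
  · simp
  · refine Finset.sum_congr rfl fun n hn => ?_
    congr 1
    clear h hn
    induction n with
    | zero => simp
    | succ n ih => rw [pow_succ', ih, pow_succ' _ n, Module.End.mul_apply, LinearMap.mul_apply']

end IsAlgFiltration

end ExpSeries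

/-! ### Affine operators on `𝔽_p × A` and the exponential of a pre-Lie algebra. -/

section Affine

variable {p : ℕ} [Fact p.Prime] {A V : Type*} [AddCommGroup A] [Module (ZMod p) A]
  [AddCommGroup V] [Module (ZMod p) V]

lemma map_mem_polyFun {C : ℕ → Submodule (ZMod p) A} {C' : ℕ → Submodule (ZMod p) V} {k : ℕ}
    (φ : A →ₗ[ZMod p] V) (h : ∀ i, ∀ v ∈ C i, φ v ∈ C' i) {f : ZMod p → A}
    (hf : f ∈ polyFun C k) : (fun t => φ (f t)) ∈ polyFun C' k := by
  have : polyFun C k ≤ (polyFun C' k).comap (φ.compLeft (ZMod p)) := by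
    refine Submodule.span_le.2 ?_
    rintro _ ⟨i, hi, v, hv, rfl⟩
    have := monomial_mem_polyFun hi (h i v hv)
    simp only [← map_smul] at this
    exact this
  exact this hf

lemma euler_eval (k : ℕ) (M : ZMod p → Module.End (ZMod p) V) (v : V) (t : ZMod p) :
    euler k (fun t => M t v) t = euler k M t v :=
  euler_map k M (LinearMap.applyₗ v) t

/-- The endomorphisms which raise the filtration degree by at least `n`. -/
def endFiltration (W : ℕ → Submodule (ZMod p) V) (n : ℕ) :
    Submodule (ZMod p) (Module.End (ZMod p) V) where
  carrier := {f | ∀ j, ∀ v ∈ W j, f v ∈ W (j + n)}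
  add_mem' hf hg j v hv := Submodule.add_mem _ (hf j v hv) (hg j v hv)
  zero_mem' _ _ _ := Submodule.zero_mem _
  smul_mem' c _ hf j v hv := Submodule.smul_mem _ c (hf j v hv)

lemma isAlgFiltration_endFiltration {W : ℕ → Submodule (ZMod p) V} {k : ℕ} (anti : Antitone W)
    (top : W 0 = ⊤) (bot : W k = ⊥) : IsAlgFiltration (endFiltration W) k where
  anti i j hij f hf n v hv := anti (by omega) (hf n v hv)
  one_mem j v hv := hv
  mul_mem i j f g hf hg n v hv := by
    rw [Module.End.mul_apply, show n + (i + j) = (n + j) + i by omega]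
    exact hf _ _ (hg _ _ hv)
  bot := by
    refine (Submodule.eq_bot_iff _).2 fun f hf => LinearMap.ext fun v => ?_
    have := hf 0 v (top ▸ Submodule.mem_top)
    rwa [zero_add, bot, Submodule.mem_bot] at this

/-- The filtration of `𝔽_p × A` induced by a filtration of `A`. -/
def affineFiltration (C : ℕ → Submodule (ZMod p) A) (n : ℕ) : Submodule (ZMod p) (ZMod p × A) :=
  if n = 0 then ⊤ else Submodule.prod ⊥ (C n)

variable {C : ℕ → Submodule (ZMod p) A} {k : ℕ}

lemma mem_affineFiltration {n : ℕ} (hn : n ≠ 0) {v : ZMod p × A} :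
    v ∈ affineFiltration C n ↔ v.1 = 0 ∧ v.2 ∈ C n := by
  simp [affineFiltration, hn, Submodule.mem_prod]

lemma affineFiltration_zero : affineFiltration C 0 = ⊤ := by simp [affineFiltration]

lemma affineFiltration_bot (hk : 0 < k) (bot : C k = ⊥) : affineFiltration C k = ⊥ := by
  rw [affineFiltration, if_neg hk.ne', bot, Submodule.prod_bot]

lemma affineFiltration_antitone (anti : Antitone C) : Antitone (affineFiltration C) := by
  intro i j hij v hv
  by_cases hi : i = 0
  · simp [hi, affineFiltration_zero]
  · rw [mem_affineFiltration (by omega)] at hv ⊢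
    exact ⟨hv.1, anti hij hv.2⟩

lemma isAlgFiltration_affine (hk : 0 < k) (anti : Antitone C) (bot : C k = ⊥) :
    IsAlgFiltration (endFiltration (affineFiltration C)) k :=
  isAlgFiltration_endFiltration (affineFiltration_antitone anti) affineFiltration_zero
    (affineFiltration_bot hk bot)

lemma eval_mem_polyFun (hk : 0 < k) (anti : Antitone C) (bot : C k = ⊥)
    {M : ZMod p → Module.End (ZMod p) (ZMod p × A)}
    (hM : M ∈ polyFun (endFiltration (affineFiltration C)) k) (v : ZMod p × A) :
    (fun t => M t v) ∈ polyFun (affineFiltration C) k :=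
  map₂_mem_polyFun (β := LinearMap.id) (C := endFiltration (affineFiltration C))
    (C' := affineFiltration C)
    (fun i j f w hf hw => by rw [add_comm]; exact hf j w hw) (affineFiltration_antitone anti)
    (affineFiltration_bot hk bot) hM (const_mem_polyFun hk (by simp [affineFiltration_zero]))

lemma eval_snd_mem_polyFun (hk : 0 < k) (anti : Antitone C) (top : C 0 = ⊤) (bot : C k = ⊥)
    {M : ZMod p → Module.End (ZMod p) (ZMod p × A)}
    (hM : M ∈ polyFun (endFiltration (affineFiltration C)) k) (v : ZMod p × A) :
    (fun t => (M t v).2) ∈ polyFun C k := by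
  refine map_mem_polyFun (LinearMap.snd (ZMod p) (ZMod p) A) ?_ (eval_mem_polyFun hk anti bot hM v)
  intro i w hw
  by_cases hi : i = 0
  · simp [hi, top]
  · exact ((mem_affineFiltration hi).1 hw).2

/-- The action `(s, b) ↦ (0, s a + a b)` of an algebra `A` on `𝔽_p × A`. -/
def affineMul (mul : A →ₗ[ZMod p] A →ₗ[ZMod p] A) :
    A →ₗ[ZMod p] Module.End (ZMod p) (ZMod p × A) :=
  LinearMap.mk₂ (ZMod p) (fun a v => (0, v.1 • a + mul a v.2))
    (fun a b v => by ext <;> simp; abel) (fun c a v => by ext <;> simp [smul_comm c])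
    (fun a v w => by ext <;> simp [add_smul]; abel) (fun c a v => by ext <;> simp [mul_smul])

variable {mul : A →ₗ[ZMod p] A →ₗ[ZMod p] A}

@[simp]
lemma affineMul_apply (a : A) (v : ZMod p × A) :
    affineMul mul a v = (0, v.1 • a + mul a v.2) := rfl

lemma affineMul_pow_apply (a b : A) (n : ℕ) :
    (affineMul mul a ^ n) (0, b) = (0, (mul a ^ n) b) := by
  induction n with
  | zero => simp
  | succ n ih => rw [pow_succ', Module.End.mul_apply, ih]; simp [pow_succ']

lemma affineMul_pow_succ_apply (a : A) (n : ℕ) :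
    (affineMul mul a ^ (n + 1)) (1, 0) = (0, (mul a ^ n) a) := by
  rw [pow_succ, Module.End.mul_apply, affineMul_apply]
  simp [affineMul_pow_apply]

namespace IsMulFiltration

variable (hC : IsMulFiltration mul C k) (top : C 1 = ⊤)
include hC

include top in
lemma zero_eq_top : C 0 = ⊤ := top_le_iff.1 (top.symm.le.trans (hC.anti (Nat.zero_le 1)))

include top in
lemma affineMul_mem {a : A} {n : ℕ} (ha : a ∈ C n) :
    affineMul mul a ∈ endFiltration (affineFiltration C) n := by
  intro j v hv
  by_cases hj : j = 0
  · by_cases hn : n = 0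
    · simp [hj, hn, affineFiltration_zero]
    · rw [mem_affineFiltration (by omega), affineMul_apply, hj, zero_add]
      refine ⟨rfl, Submodule.add_mem _ (Submodule.smul_mem _ _ ha)
        (hC.mul_mem n 0 _ _ ha (hC.zero_eq_top top ▸ Submodule.mem_top))⟩
  · rw [mem_affineFiltration hj] at hv
    rw [mem_affineFiltration (by omega), affineMul_apply]
    refine ⟨rfl, ?_⟩
    rw [hv.1, zero_smul, zero_add, add_comm]
    exact hC.mul_mem _ _ _ _ ha hv.2

lemma isAlgFiltration_affine (hk : 0 < k) :
    IsAlgFiltration (endFiltration (affineFiltration C)) k :=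
  _root_.isAlgFiltration_affine hk hC.anti hC.bot

include top in
lemma affineMul_mem_one (a : A) : affineMul mul a ∈ endFiltration (affineFiltration C) 1 :=
  hC.affineMul_mem top (top ▸ Submodule.mem_top)

include top in
lemma truncExp_affineMul_apply (hk : 0 < k) (a : A) (s : ZMod p) (b : A) :
    truncExp p k (affineMul mul a) (s, b) =
      (s, s • expSeries mul k a + ∑ n ∈ range k, (n.factorial : ZMod p)⁻¹ • ((mul a) ^ n) b) := by
  have h1 : truncExp p k (affineMul mul a) (1, 0) = (1, expSeries mul k a) := by
    have hG := hC.isAlgFiltration_affine hk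
    have h : truncExp p k (affineMul mul a) = truncExp p (k + 1) (affineMul mul a) := by
      rw [truncExp, truncExp, Finset.sum_range_succ,
        hG.eq_zero le_rfl (hG.pow_mem (hC.affineMul_mem_one top a) k), smul_zero, add_zero]
    rw [h, truncExp, Finset.sum_range_succ', expSeries]
    simp only [LinearMap.add_apply, LinearMap.sum_apply, LinearMap.smul_apply,
      affineMul_pow_succ_apply]
    ext
    · simp [Prod.fst_sum]
    · simp [Prod.snd_sum]
  have h2 : truncExp p k (affineMul mul a) (0, b) =
      (0, ∑ n ∈ range k, (n.factorial : ZMod p)⁻¹ • ((mul a) ^ n) b) := by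
    simp only [truncExp, LinearMap.sum_apply, LinearMap.smul_apply, affineMul_pow_apply]
    ext
    · simp [Prod.fst_sum]
    · simp [Prod.snd_sum]
  have e : ((s, b) : ZMod p × A) = s • (1, 0) + (0, b) := by ext <;> simp
  rw [e, map_add, map_smul, h1, h2]
  ext <;> simp

include top in
lemma affineMul_mem_polyFun {z : ZMod p → A} (hz : z ∈ polyFun C k) :
    (fun t => affineMul mul (z t)) ∈ polyFun (endFiltration (affineFiltration C)) k :=
  map_mem_polyFun _ (fun _ _ ha => hC.affineMul_mem top ha) hz

include top in
lemma truncExp_affineMul_mem_polyFun (hk : 0 < k) {z : ZMod p → A} (hz : z ∈ polyFun C k) :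
    (fun t => truncExp p k (affineMul mul (z t))) ∈
      polyFun (endFiltration (affineFiltration C)) k := by
  convert (hC.isAlgFiltration_affine hk).truncExp_mem_polyFun hk (hC.affineMul_mem_polyFun top hz)
    using 1
  ext1 t
  rw [truncExp_pi_apply]

variable (preLie : ∀ x y z, mul (mul x y) z - mul x (mul y z) = mul (mul y x) z - mul y (mul x z))
include top preLie

/-- The logarithmic derivative of `exp` along a curve in a pre-Lie algebra. -/
lemma exists_euler_truncExp_eq (hp : 2 ^ k < p) (hk : 0 < k) {z : ZMod p → A}
    (hz : z ∈ polyFun C k) : ∃ y : ZMod p → A,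
      euler k (fun t => truncExp p k (affineMul mul (z t))) =
        (fun t => affineMul mul (y t)) * fun t => truncExp p k (affineMul mul (z t)) := by
  have hG := hC.isAlgFiltration_affine hk
  -- These are the iterated commutators ad(z)^l (t z') formed in A. By the pre-Lie identity
  -- `affineMul` turns them into commutators of operators, so the logarithmic derivative again has
  -- the form `affineMul mul y`.
  let v : ℕ → ZMod p → A := fun n => Nat.rec (euler k z)
    (fun _ v t => mul (z t) (v t) - mul (v t) (z t)) n
  have hv : ∀ l t, v l t ∈ C (l + 1) := by
    intro l t
    induction l with
    | zero => exact top ▸ Submodule.mem_top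
    | succ l ih =>
      have hzt : z t ∈ C 1 := top ▸ Submodule.mem_top
      refine Submodule.sub_mem _ ?_ (hC.mul_mem _ _ _ _ ih hzt)
      rw [add_comm]
      exact hC.mul_mem _ _ _ _ hzt ih
  have e : (fun t => truncExp p k (affineMul mul (z t))) =
      truncExp p k (fun t => affineMul mul (z t)) := by
    ext1 t; rw [truncExp_pi_apply]
  refine ⟨∑ l ∈ range k, ((l + 1).factorial : ZMod p)⁻¹ • v l, ?_⟩
  rw [e, hG.euler_truncExp hp hk (hC.affineMul_mem_polyFun top hz)
    (w := fun l t => affineMul mul (v l t))]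
  · congr 1
    ext1 t
    simp
  · ext1 t
    rw [euler_map]
    rfl
  · intro l
    ext1 t
    have h1 : v (l + 1) t = mul (z t) (v l t) - mul (v l t) (z t) := rfl
    simp only [Pi.mul_apply, Pi.add_apply, h1]
    refine LinearMap.ext fun u => ?_
    have := preLie (z t) (v l t) u.2
    simp only [Module.End.mul_apply, affineMul_apply, LinearMap.add_apply, map_sub, map_add,
      map_smul, LinearMap.sub_apply, zero_smul, zero_add, Prod.mk_add_mk, add_zero,
      Prod.mk.injEq, true_and, Prod.mk_sub_mk, sub_self]
    rw [sub_eq_sub_iff_add_eq_add] at this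
    have h2 : mul (z t) (mul (v l t) u.2) = mul (mul (z t) (v l t)) u.2 -
        mul (mul (v l t) (z t)) u.2 + mul (v l t) (mul (z t) u.2) := by
      rw [sub_add_eq_add_sub, this]; abel
    rw [h2]
    abel
  · intro l m hlm
    ext1 t
    exact hG.eq_zero hlm (hG.mul_mem _ _ _ _ (hC.affineMul_mem top (hv l t))
      (hG.pow_mem (hC.affineMul_mem_one top (z t)) m))

/-- The exponentials of the affine operators of a nilpotent pre-Lie algebra are closed under
multiplication. -/
lemma truncExp_mul_truncExp (hp : 2 ^ k < p) (hk : 0 < k) {x y z : A}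
    (h : expSeries mul k z = expSeries mul k x +
      ∑ n ∈ range k, (n.factorial : ZMod p)⁻¹ • ((mul x) ^ n) (expSeries mul k y)) :
    truncExp p k (affineMul mul z) =
      truncExp p k (affineMul mul x) * truncExp p k (affineMul mul y) := by
  have hG := hC.isAlgFiltration_affine hk
  have hx := hC.affineMul_mem_one top x
  have mem1 : ∀ a : A, a ∈ C 1 := fun a => top ▸ Submodule.mem_top
  set b := expSeries mul k y with hb
  have hK := hG.truncExp_linear_mem hk hx
  -- c(t) is the orbit of (1, W(y)) under exp(tx). Its preimage ζ under W runs from y to z, and the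
  -- aim is exp(ζ(t)) = exp(tx) exp(y) at t = 1.
  obtain ⟨c, hc, hcK⟩ : ∃ c ∈ polyFun C k, ∀ t : ZMod p,
      truncExp p k (t • affineMul mul x) (1, b) = (1, c t) := by
    refine ⟨_, eval_snd_mem_polyFun hk hC.anti (hC.zero_eq_top top) hC.bot hK (1, b), fun t => ?_⟩
    rw [← map_smul, hC.truncExp_affineMul_apply top hk]
  obtain ⟨ζ, hζ, hζc⟩ := hC.exists_polyFun_expSeries_eq hk hc
  have hζ0 : ζ 0 = y := by
    refine hC.expSeries_injOn hk (mem1 _) (mem1 _) ?_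
    have := hcK 0
    rw [zero_smul, truncExp_zero hk] at this
    rw [hζc, ← hb]
    exact (congrArg Prod.snd this).symm
  have hζ1 : ζ 1 = z := by
    refine hC.expSeries_injOn hk (mem1 _) (mem1 _) ?_
    have := hcK 1
    rw [one_smul, hC.truncExp_affineMul_apply top hk, one_smul] at this
    rw [hζc, h]
    exact (congrArg Prod.snd this).symm
  have hM := hC.truncExp_affineMul_mem_polyFun top hk hζ
  obtain ⟨w, hw⟩ := hC.exists_euler_truncExp_eq top preLie hp hk hζ
  have hMc : ∀ t, truncExp p k (affineMul mul (ζ t)) (1, 0) = (1, c t) := by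
    intro t
    rw [hC.truncExp_affineMul_apply top hk, hζc]
    simp
  -- Both curves of operators produce the same orbit c, so evaluating their derivatives gives w + w
  -- c = t x + (t x) c. The difference d = w - t x satisfies d = -d c, hence lies in every step of
  -- the filtration and vanishes.
  have hwx : ∀ t, w t = t • x := by
    intro t
    have e1 : euler k (fun t => truncExp p k (affineMul mul (ζ t)) (1, 0)) t =
        affineMul mul (w t) (1, c t) := by
      rw [euler_eval, hw, ← hMc]
      rfl
    have e2 : euler k (fun t : ZMod p => truncExp p k (t • affineMul mul x) (1, b)) t =
        (t • affineMul mul x) (1, c t) := by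
      rw [euler_eval,
        hG.euler_truncExp_linear hp hk hx, ← hcK]
      rfl
    simp only [hMc] at e1
    simp only [hcK] at e2
    have e3 : affineMul mul (w t - t • x) (1, c t) = 0 := by
      rw [map_sub, map_smul, LinearMap.sub_apply, ← e1, e2, sub_self]
    have e4 : (w t - t • x) + mul (w t - t • x) (c t) = 0 := by
      simpa only [affineMul_apply, one_smul, Prod.snd_zero] using congrArg Prod.snd e3
    have key : ∀ n, w t - t • x ∈ C (n + 1) := by
      intro n
      induction n with
      | zero => exact mem1 _
      | succ n ih =>
        rw [eq_neg_of_add_eq_zero_left e4]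
        exact Submodule.neg_mem _ (hC.mul_mem _ _ _ _ ih (mem1 _))
    have := hC.anti (Nat.le_succ k) (key k)
    rwa [hC.bot, Submodule.mem_bot, sub_eq_zero] at this
  have := hG.apply_one_eq_of_euler_eq hp hk hx hM (by rw [hw]; simp only [hwx, map_smul])
  rwa [hζ0, hζ1] at this

end IsMulFiltration

end Affine

/-! ### The strong chain and the product attached to a brace. -/

namespace LeftBrace

variable {A : Type*} [AddCommGroup A] (B : LeftBrace A)

lemma strongChain_one : B.strongChain 1 = ⊤ := by rw [strongChain]

lemma strongChain_le {n : ℕ} (hn : 2 ≤ n) {H : AddSubgroup A}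
    (h : ∀ i j, 1 ≤ i → 1 ≤ j → i + j = n → ∀ a ∈ B.strongChain i, ∀ b ∈ B.strongChain j,
      B.star a b ∈ H) : B.strongChain n ≤ H := by
  obtain ⟨n, rfl⟩ : ∃ m, n = m + 2 := ⟨n - 2, by omega⟩
  rw [strongChain]
  refine iSup_le fun j => (AddSubgroup.closure_le _).2 ?_
  rintro _ ⟨a, ha, b, hb, rfl⟩
  have := j.2
  exact h _ _ (by omega) (by omega) (by omega) a ha b hb

lemma star_mem_strongChain {i j : ℕ} (hi : 1 ≤ i) (hj : 1 ≤ j) {a b : A}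
    (ha : a ∈ B.strongChain i) (hb : b ∈ B.strongChain j) :
    B.star a b ∈ B.strongChain (i + j) := by
  obtain ⟨i, rfl⟩ : ∃ m, i = m + 1 := ⟨i - 1, by omega⟩
  obtain ⟨j, rfl⟩ : ∃ m, j = m + 1 := ⟨j - 1, by omega⟩
  have e : i + 1 + (j + 1) = i + j + 2 := by omega
  rw [e, strongChain]
  refine AddSubgroup.mem_iSup_of_mem (⟨i, by omega⟩ : Fin (i + j + 1))
    (AddSubgroup.subset_closure ⟨a, ha, b, ?_, rfl⟩)
  rwa [show i + j + 1 - i = j + 1 by omega]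

/-- Lower the index of one factor of each generator: the right factor if the left one has index 1,
and the left factor otherwise. -/
lemma strongChain_succ_le (n : ℕ) (hn : 1 ≤ n) : B.strongChain (n + 1) ≤ B.strongChain n := by
  induction n using Nat.strong_induction_on with
  | _ n ih =>
    rcases hn.eq_or_lt with rfl | hn
    · rw [strongChain_one]; exact le_top
    refine B.strongChain_le (by omega) fun i j hi hj hij a ha b hb => ?_
    rcases hi.eq_or_lt with rfl | hi'
    · obtain ⟨j, rfl⟩ : ∃ m, j = m + 1 := ⟨j - 1, by omega⟩
      rw [show n = 1 + j by omega]
      exact B.star_mem_strongChain le_rfl (by omega) ha (ih j (by omega) (by omega) hb)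
    · obtain ⟨i, rfl⟩ : ∃ m, i = m + 1 := ⟨i - 1, by omega⟩
      rw [show n = i + j by omega]
      exact B.star_mem_strongChain (by omega) hj (ih i (by omega) (by omega) ha) hb

end LeftBrace

namespace FieldBrace

variable {p : ℕ} [Fact p.Prime] {A : Type*} [AddCommGroup A] [Module (ZMod p) A]
  (B : FieldBrace (ZMod p) A)

lemma dot_eq_polyCoeff (a b : A) :
    B.dot a b = polyCoeff 1 fun t : ZMod p => B.star (t • a) b := by
  rw [dot, polyCoeff_apply]
  congr 1
  refine Finset.sum_congr rfl fun i _ => ?_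
  rw [pow_one, ← Nat.cast_smul_eq_nsmul (ZMod p)]
  push_cast
  rfl

lemma dot_mem_strongChain {i j : ℕ} (hi : 1 ≤ i) (hj : 1 ≤ j) {a b : A}
    (ha : a ∈ B.strongChain i) (hb : b ∈ B.strongChain j) :
    B.dot a b ∈ B.strongChain (i + j) := by
  rw [dot]
  refine neg_mem (sum_mem fun n _ => ?_)
  exact (AddSubgroup.toZModSubmodule p (B.strongChain (i + j))).smul_mem _
    (B.star_mem_strongChain hi hj (nsmul_mem ha _) hb)

end FieldBrace

/-! ### From pre-Lie algebras to braces: the group of flows. -/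

namespace PreLieStructure

variable {p : ℕ} [Fact p.Prime] {A : Type*} [AddCommGroup A] [Module (ZMod p) A]
  (P : PreLieStructure (ZMod p) A)

variable {P} in
lemma IsProduct.pos {n : ℕ} {x : A} (h : P.IsProduct n x) : 1 ≤ n := by
  induction h with
  | single => exact le_rfl
  | mul _ _ h1 h2 => omega

variable {P} in
lemma IsProduct.pred {n : ℕ} {x : A} (h : P.IsProduct n x) (hn : 2 ≤ n) :
    P.IsProduct (n - 1) x := by
  induction h with
  | single => omega
  | @mul m n a b ha hb iha ihb =>
    have := ha.pos
    have := hb.pos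
    by_cases hm : 2 ≤ m
    · rw [show m + n - 1 = (m - 1) + n by omega]
      exact (iha hm).mul hb
    by_cases hn : 2 ≤ n
    · rw [show m + n - 1 = m + (n - 1) by omega]
      exact ha.mul (ihb hn)
    · rw [show m + n - 1 = 1 by omega]
      exact .single _

/-- The span of all products of `n` elements (and the whole algebra for `n = 0`). -/
def powerFiltration (n : ℕ) : Submodule (ZMod p) A :=
  if n = 0 then ⊤ else Submodule.span (ZMod p) {x | P.IsProduct n x}

lemma powerFiltration_zero : P.powerFiltration 0 = ⊤ := by simp [powerFiltration]

lemma powerFiltration_of_pos {n : ℕ} (hn : 1 ≤ n) :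
    P.powerFiltration n = Submodule.span (ZMod p) {x | P.IsProduct n x} := by
  rw [powerFiltration, if_neg (by omega)]

lemma powerFiltration_one : P.powerFiltration 1 = ⊤ := by
  rw [powerFiltration_of_pos _ le_rfl]
  exact top_le_iff.1 fun x _ => Submodule.subset_span (.single x)

lemma powerFiltration_antitone : Antitone P.powerFiltration := by
  refine antitone_nat_of_succ_le fun n => ?_
  rcases n with _ | n
  · rw [powerFiltration_zero]; exact le_top
  · rw [powerFiltration_of_pos _ (by omega), powerFiltration_of_pos _ (by omega)]
    exact Submodule.span_mono fun x hx => IsProduct.pred hx (by omega)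

lemma mul_mem_powerFiltration {i j : ℕ} {a b : A} (ha : a ∈ P.powerFiltration i)
    (hb : b ∈ P.powerFiltration j) : P.mul a b ∈ P.powerFiltration (i + j) := by
  have key : ∀ i j : ℕ, 1 ≤ i → 1 ≤ j → ∀ a b, a ∈ P.powerFiltration i →
      b ∈ P.powerFiltration j → P.mul a b ∈ P.powerFiltration (i + j) := by
    intro i j hi hj a b ha hb
    rw [powerFiltration_of_pos _ (by omega)] at ha hb ⊢
    have := Submodule.apply_mem_map₂ P.mul ha hb
    rw [Submodule.map₂_span_span] at this
    refine Submodule.span_mono ?_ this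
    rintro _ ⟨x, hx, y, hy, rfl⟩
    exact IsProduct.mul hx hy
  have top : ∀ x : A, x ∈ P.powerFiltration 1 := fun x => P.powerFiltration_one ▸ Submodule.mem_top
  rcases i with _ | i <;> rcases j with _ | j
  · rw [powerFiltration_zero]; exact Submodule.mem_top
  · exact P.powerFiltration_antitone (by omega) (key 1 (j + 1) le_rfl (by omega) a b (top a) hb)
  · exact P.powerFiltration_antitone (by omega) (key (i + 1) 1 (by omega) le_rfl a b ha (top b))
  · exact key _ _ (by omega) (by omega) a b ha hb

lemma powerFiltration_eq_bot_iff {n : ℕ} (hn : 1 ≤ n) :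
    P.powerFiltration n = ⊥ ↔ ∀ x, P.IsProduct n x → x = 0 := by
  rw [powerFiltration_of_pos _ hn, Submodule.span_eq_bot]
  rfl

variable {P} {k : ℕ}

section

variable (hk : 0 < k) (hP : ∀ x, P.IsProduct k x → x = 0)
include hk hP

lemma isMulFiltration : IsMulFiltration P.mul P.powerFiltration k where
  anti := P.powerFiltration_antitone
  mul_mem _ _ _ _ := P.mul_mem_powerFiltration
  zero_le := by rw [powerFiltration_one]; exact le_top
  bot := (P.powerFiltration_eq_bot_iff hk).2 hP

lemma W_bijective : Function.Bijective (P.W k) := by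
  have hC := isMulFiltration hk hP
  have top : ∀ x : A, x ∈ P.powerFiltration 1 := fun x => P.powerFiltration_one ▸ Submodule.mem_top
  refine ⟨fun x y h => hC.expSeries_injOn hk (top x) (top y) h, fun c => ?_⟩
  obtain ⟨x, _, hx⟩ := hC.exists_expSeries_eq hk (top c)
  exact ⟨x, hx⟩

lemma W_Ω (a : A) : P.W k (P.Ω k a) = a :=
  Function.rightInverse_invFun (W_bijective hk hP).2 a

lemma Ω_eq_of_W_eq {x a : A} (h : P.W k x = a) : P.Ω k a = x :=
  (W_bijective hk hP).1 (by rw [W_Ω hk hP, h])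

lemma truncExp_affineMul_apply (a : A) (s : ZMod p) (b : A) :
    truncExp p k (affineMul P.mul a) (s, b) = (s, s • P.W k a + P.expL k a b) :=
  (isMulFiltration hk hP).truncExp_affineMul_apply P.powerFiltration_one hk a s b

omit hk hP in
lemma expL_add (a b c : A) : P.expL k a (b + c) = P.expL k a b + P.expL k a c := by
  simp [expL, Finset.sum_add_distrib]

omit hk hP in
lemma expL_smul (a : A) (s : ZMod p) (b : A) : P.expL k a (s • b) = s • P.expL k a b := by
  simp [expL, Finset.smul_sum, smul_comm s]

variable (hp : 2 ^ k < p)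
include hp

/-- The hypothesis says that z is the product of x and y in logarithmic coordinates; the linear part
of the resulting identity of affine operators gives the claim. -/
lemma expL_eq_of_W_eq {x y z : A} (h : P.W k z = P.W k x + P.expL k x (P.W k y)) (v : A) :
    P.expL k z v = P.expL k x (P.expL k y v) := by
  have h1 := (isMulFiltration hk hP).truncExp_mul_truncExp P.powerFiltration_one P.preLie hp hk h
  have h2 := congrArg (fun f => (f (0, v)).2) h1
  simpa [truncExp_affineMul_apply hk hP] using h2

lemma truncExp_affineMul_neg (x : A) :
    truncExp p k (affineMul P.mul x) * truncExp p k (affineMul P.mul (-x)) = 1 := by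
  have hC := isMulFiltration hk hP
  rw [map_neg]
  exact (hC.isAlgFiltration_affine hk).truncExp_mul_truncExp_neg hp hk
    (hC.affineMul_mem_one P.powerFiltration_one x)

lemma W_add_expL_W_neg (x : A) : P.W k x + P.expL k x (P.W k (-x)) = 0 := by
  have h := congrArg (fun f => (f (1, 0)).2) (truncExp_affineMul_neg hk hP hp x)
  have h0 : ∀ a : A, P.expL k a 0 = 0 := fun a => by simp [expL]
  simpa [truncExp_affineMul_apply hk hP, h0, -map_neg] using h

lemma flow_assoc (a b c : A) :
    P.flow k (P.flow k a b) c = P.flow k a (P.flow k b c) := by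
  have h := expL_eq_of_W_eq hk hP hp (x := P.Ω k a) (y := P.Ω k b) (z := P.Ω k (P.flow k a b))
    (by simp only [W_Ω hk hP]; rfl)
  rw [flow, h]
  simp only [flow, expL_add]
  rw [add_assoc]

omit hk hP hp in
lemma W_zero : P.W k 0 = 0 := by simp [W]

/-- The group of flows of a nilpotent pre-Lie algebra, as a brace. -/
def flowBrace : FieldBrace (ZMod p) A where
  circ := P.flow k
  circ_assoc := flow_assoc hk hP hp
  exists_one_inv := by
    have hΩ0 : P.Ω k 0 = 0 := Ω_eq_of_W_eq hk hP W_zero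
    have h0 : ∀ v : A, P.expL k 0 v = v := by
      intro v
      have := congrArg Prod.snd (truncExp_affineMul_apply hk hP 0 0 v)
      rw [map_zero, truncExp_zero hk] at this
      simpa using this.symm
    refine ⟨0, fun a => ⟨?_, ?_⟩, fun a => ⟨P.W k (-P.Ω k a), ?_, ?_⟩⟩
    · rw [flow, hΩ0, h0, zero_add]
    · simp [flow, expL]
    · have := W_add_expL_W_neg hk hP hp (P.Ω k a)
      rwa [W_Ω hk hP] at this
    · have := W_add_expL_W_neg hk hP hp (-P.Ω k a)
      rw [neg_neg, W_Ω hk hP] at this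
      rw [flow, Ω_eq_of_W_eq hk hP rfl, this]
  circ_add a b c := by
    simp only [flow, expL_add]
    abel
  star_smul a s b := by
    simp only [LeftBrace.star, flow, expL_smul]
    simp [smul_sub]

lemma flowBrace_star (a b : A) :
    (flowBrace hk hP hp).star a b = P.expL k (P.Ω k a) b - b := by
  change P.flow k a b - a - b = _
  rw [flow]
  abel

/-- With z(t) = Ω(t a), the curve (t a) * b is the sum of L_{z(t)}^n(b) / n! over n ≥ 1. Since z(0)
= 0 and z has linear coefficient a, only n = 1 contributes to the coefficient of t, and it
contributes a · b. -/
lemma flowBrace_dot (a b : A) : (flowBrace hk hP hp).dot a b = P.mul a b := by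
  have hC := isMulFiltration hk hP
  have top : ∀ x : A, x ∈ P.powerFiltration 1 := fun x => P.powerFiltration_one ▸ Submodule.mem_top
  -- The line t ↦ t a is a polynomial function of degree below k only if k > 1; for k = 1 the
  -- algebra is zero.
  rcases (Nat.succ_le_of_lt hk).eq_or_lt with hk1 | hk1
  · obtain rfl : k = 1 := hk1.symm
    have : ∀ x : A, x = 0 := fun x => hP x (.single x)
    rw [this (P.mul a b)]
    exact this _
  have hb : (fun _ : ZMod p => b) ∈ polyFun P.powerFiltration k :=
    const_mem_polyFun hk (P.powerFiltration_zero ▸ Submodule.mem_top)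
  have hc : (fun t : ZMod p => t • a) ∈ polyFun P.powerFiltration k := by
    simpa using monomial_mem_polyFun hk1 (top a)
  have hc1 : polyCoeff 1 (fun t : ZMod p => t • a) = a := by
    simpa using polyCoeff_monomial hp hk hk hk a
  have hb1 : polyCoeff 1 (fun _ : ZMod p => b) = 0 := by
    simpa using polyCoeff_monomial hp hk hk hk.le (j := 0) b
  obtain ⟨z, hz, hzc⟩ := hC.exists_polyFun_expSeries_eq hk hc
  have hz0 : z 0 = 0 := hC.expSeries_injOn hk (top _) (top _) (by
    rw [hzc, zero_smul, expSeries_zero])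
  have hz1 : polyCoeff 1 z = a := by
    rw [← hC.polyCoeff_one_expSeries hp hk hz hz0]
    simp only [hzc, hc1]
  have hstar : (fun t : ZMod p => (flowBrace hk hP hp).star (t • a) b) =
      (∑ n ∈ range k, (n.factorial : ZMod p)⁻¹ • fun t => ((P.mul (z t)) ^ n) b) -
        fun _ => b := by
    ext t
    rw [flowBrace_star, Ω_eq_of_W_eq hk hP (hzc t)]
    simp [expL]
  rw [FieldBrace.dot_eq_polyCoeff, hstar, map_sub, hb1, sub_zero, map_sum]
  obtain ⟨k, rfl⟩ : ∃ m, k = m + 2 := ⟨k - 2, by omega⟩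
  rw [Finset.sum_range_succ', Finset.sum_range_succ']
  simp only [map_smul]
  rw [Finset.sum_eq_zero fun n _ => by rw [hC.polyCoeff_one_pow_apply hp hk hz hb hz0, smul_zero]]
  simp only [zero_add, pow_one, pow_zero, Module.End.one_apply, hb1, smul_zero, add_zero,
    Nat.factorial_one, Nat.cast_one, inv_one, one_smul]
  rw [polyCoeff_one_map₂ hp hk hC.mul_mem hC.anti hC.bot hz hb, hz1, hb1, map_zero, add_zero]

/-- One inclusion holds because Ω preserves the powers and a * b is a combination of products
containing Ω(a) and b; the other because the pre-Lie product is recovered as a combination of values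
of `*`. -/
lemma flowBrace_strongChain {n : ℕ} (hn : 1 ≤ n) :
    (flowBrace hk hP hp).strongChain n = (P.powerFiltration n).toAddSubgroup := by
  have hC := isMulFiltration hk hP
  have top : ∀ x : A, x ∈ P.powerFiltration 1 := fun x => P.powerFiltration_one ▸ Submodule.mem_top
  refine le_antisymm ?_ ?_
  · induction n using Nat.strong_induction_on with
    | _ n ih =>
      rcases hn.eq_or_lt with rfl | hn
      · rw [powerFiltration_one]; exact le_top
      refine LeftBrace.strongChain_le _ hn fun i j hi hj hij a ha b hb => ?_
      replace ha : a ∈ P.powerFiltration i := ih i (by omega) hi ha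
      replace hb : b ∈ P.powerFiltration j := ih j (by omega) hj hb
      rw [flowBrace_star]
      have hΩ : P.Ω k a ∈ P.powerFiltration i :=
        hC.mem_of_expSeries_mem hk (top _) (by
          change P.W k _ ∈ _
          rwa [W_Ω hk hP])
      obtain ⟨k, rfl⟩ : ∃ m, k = m + 1 := ⟨k - 1, by omega⟩
      rw [expL, Finset.sum_range_succ']
      simp only [pow_zero, Module.End.one_apply, Nat.factorial_zero, Nat.cast_one, inv_one,
        one_smul, add_sub_cancel_right]
      refine Submodule.sum_mem _ fun m _ => Submodule.smul_mem _ _ ?_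
      -- The innermost factor supplies index i + j; the remaining factors can only increase it.
      rw [pow_succ, Module.End.mul_apply]
      have := hC.pow_apply_mem (top (P.Ω (k + 1) a)) (hC.mul_mem _ _ _ _ hΩ hb) m
      exact hC.anti (by omega) this
  · rw [powerFiltration_of_pos _ hn]
    change _ ≤ (AddSubgroup.toZModSubmodule p ((flowBrace hk hP hp).strongChain n)).toAddSubgroup
    refine Submodule.span_le.2 fun x hx => ?_
    change x ∈ (flowBrace hk hP hp).strongChain n
    replace hx : P.IsProduct n x := hx
    clear hn
    induction hx with
    | single a => rw [LeftBrace.strongChain_one]; exact AddSubgroup.mem_top _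
    | @mul m n a b ha hb iha ihb =>
      rw [← flowBrace_dot hk hP hp]
      exact FieldBrace.dot_mem_strongChain _ ha.pos hb.pos iha ihb

lemma flowBrace_hasNilpotencyIndex_iff (l : ℕ) :
    (flowBrace hk hP hp).HasNilpotencyIndex l ↔ P.HasNilpotencyIndex l := by
  rw [LeftBrace.HasNilpotencyIndex, HasNilpotencyIndex]
  have : {n : ℕ | 1 ≤ n ∧ (flowBrace hk hP hp).strongChain n = ⊥} =
      {n : ℕ | 1 ≤ n ∧ ∀ x, P.IsProduct n x → x = 0} := by
    ext n
    refine and_congr_right fun hn => ?_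
    rw [flowBrace_strongChain hk hP hp hn, ← powerFiltration_eq_bot_iff _ hn]
    exact Submodule.toAddSubgroup_injective.eq_iff (b := ⊥)
  rw [this]

end

end PreLieStructure

/-! ### The affine representation of a brace and its logarithms. -/

namespace FieldBrace

variable {p : ℕ} [Fact p.Prime] {A : Type*} [AddCommGroup A] [Module (ZMod p) A]
  (B : FieldBrace (ZMod p) A)

/-- The strong chain as a filtration by subspaces, starting at index `0`. -/
def chainFiltration (n : ℕ) : Submodule (ZMod p) A :=
  if n = 0 then ⊤ else AddSubgroup.toZModSubmodule p (B.strongChain n)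

lemma mem_chainFiltration {n : ℕ} (hn : 1 ≤ n) {x : A} :
    x ∈ B.chainFiltration n ↔ x ∈ B.strongChain n := by
  rw [chainFiltration, if_neg (by omega)]
  rfl

lemma chainFiltration_zero : B.chainFiltration 0 = ⊤ := by simp [chainFiltration]

lemma mem_chainFiltration_one (x : A) : x ∈ B.chainFiltration 1 := by
  rw [mem_chainFiltration _ le_rfl, LeftBrace.strongChain_one]
  trivial

lemma chainFiltration_antitone : Antitone B.chainFiltration := by
  refine antitone_nat_of_succ_le fun n => ?_
  rcases n with _ | n
  · rw [chainFiltration_zero]; exact le_top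
  · intro x hx
    rw [mem_chainFiltration _ (by omega)] at hx ⊢
    exact B.strongChain_succ_le _ (by omega) hx

lemma chainFiltration_eq_bot {k : ℕ} (hk : 0 < k) (hB : B.strongChain k = ⊥) :
    B.chainFiltration k = ⊥ := by
  refine (Submodule.eq_bot_iff _).2 fun x hx => ?_
  rw [mem_chainFiltration _ hk, hB] at hx
  exact hx

lemma star_mem_chainFiltration {i j : ℕ} (hi : 1 ≤ i) (hj : 1 ≤ j) {a b : A}
    (ha : a ∈ B.chainFiltration i) (hb : b ∈ B.chainFiltration j) :
    B.star a b ∈ B.chainFiltration (i + j) := by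
  rw [mem_chainFiltration _ (by omega)] at *
  exact B.star_mem_strongChain hi hj ha hb

/-- `b ↦ a * b` as a linear map. -/
def starMap (a : A) : A →ₗ[ZMod p] A where
  toFun := B.star a
  map_add' b c := by
    have := B.circ_add a b c
    simp only [LeftBrace.star]
    rw [← eq_sub_iff_add_eq] at this
    rw [this]
    abel
  map_smul' s b := B.star_smul a s b

lemma starMap_apply (a b : A) : B.starMap a b = B.star a b := rfl

lemma circ_eq (a b : A) : B.circ a b = a + b + B.starMap a b := by
  rw [starMap_apply, LeftBrace.star]
  abel

/-- The map `(s, b) ↦ (0, s a + a * b)`. -/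
def affineStar (a : A) : Module.End (ZMod p) (ZMod p × A) :=
  LinearMap.inr (ZMod p) (ZMod p) A ∘ₗ
    ((LinearMap.fst (ZMod p) (ZMod p) A).smulRight a +
      B.starMap a ∘ₗ LinearMap.snd (ZMod p) (ZMod p) A)

@[simp]
lemma affineStar_apply (a : A) (v : ZMod p × A) :
    B.affineStar a v = (0, v.1 • a + B.starMap a v.2) := rfl

/-- Associativity of `∘` expands into the composition rule for a ↦ (b ↦ a * b), which makes a ↦ 1 +
S_a a representation of (A, ∘). -/
lemma one_add_affineStar_mul (a b : A) :
    (1 + B.affineStar a) * (1 + B.affineStar b) = 1 + B.affineStar (B.circ a b) := by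
  have h : ∀ c, B.starMap (B.circ a b) c =
      B.starMap b c + B.starMap a c + B.starMap a (B.starMap b c) := by
    intro c
    have := B.circ_assoc a b c
    rw [B.circ_eq (B.circ a b) c, B.circ_eq a (B.circ b c), B.circ_eq b c, map_add, map_add,
      B.circ_eq a b] at this
    rw [B.circ_eq a b]
    have h2 := eq_sub_of_add_eq' this
    rw [h2]
    abel
  refine LinearMap.ext fun v => ?_
  simp only [Module.End.mul_apply, LinearMap.add_apply, Module.End.one_apply, affineStar_apply,
    h, map_add, map_smul]
  rw [B.circ_eq a b]
  ext
  · simp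
  · simp only [Prod.snd_add, smul_add, zero_smul]
    abel

lemma starMap_zero : B.starMap 0 = 0 := by
  obtain ⟨e, he, -⟩ := B.exists_one_inv
  have h0 : ∀ a, B.circ a 0 = a := fun a => by rw [circ_eq, map_zero, add_zero, add_zero]
  have he0 : e = 0 := by rw [← h0 e, (he 0).1]
  ext b
  have := (he b).1
  rw [he0, circ_eq, zero_add, add_eq_left] at this
  exact this

lemma affineStar_zero : B.affineStar 0 = 0 := by
  refine LinearMap.ext fun v => ?_
  simp [starMap_zero]

lemma exists_circ_eq (a b : A) : ∃ c, B.circ b c = a := by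
  obtain ⟨e, he, hinv⟩ := B.exists_one_inv
  obtain ⟨b', hb', -⟩ := hinv b
  exact ⟨B.circ b' a, by rw [← B.circ_assoc, hb', (he a).1]⟩

lemma affineStar_mem {n : ℕ} (hn : 1 ≤ n) {a : A} (ha : a ∈ B.chainFiltration n) :
    B.affineStar a ∈ endFiltration (affineFiltration B.chainFiltration) n := by
  intro j v hv
  rw [mem_affineFiltration (by omega), affineStar_apply]
  refine ⟨rfl, ?_⟩
  by_cases hj : j = 0
  · rw [hj, zero_add]
    exact Submodule.add_mem _ (Submodule.smul_mem _ _ ha) (B.chainFiltration_antitone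
      (Nat.le_succ n) (B.star_mem_chainFiltration hn le_rfl ha (B.mem_chainFiltration_one _)))
  · rw [mem_affineFiltration hj] at hv
    rw [hv.1, zero_smul, zero_add, add_comm]
    exact B.star_mem_chainFiltration hn (by omega) ha hv.2

/-- Since `*` is not additive on the left, the difference is handled multiplicatively: write a = b ∘
c, so that S_a - S_b = S_c + S_b S_c, and show that c is as deep in the chain as a - b. -/
lemma affineStar_sub_mem {n : ℕ} (hn : 1 ≤ n) {a b : A} (h : a - b ∈ B.chainFiltration n) :
    B.affineStar a - B.affineStar b ∈ endFiltration (affineFiltration B.chainFiltration) n := by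
  obtain ⟨c, rfl⟩ := B.exists_circ_eq a b
  have hc : c ∈ B.chainFiltration n := by
    have key : ∀ m, m + 1 ≤ n → c ∈ B.chainFiltration (m + 1) := by
      intro m
      induction m with
      | zero => exact fun _ => B.mem_chainFiltration_one c
      | succ m ih =>
        intro hm
        have e : c = (B.circ b c - b) - B.star b c := by rw [LeftBrace.star]; abel
        rw [e]
        refine Submodule.sub_mem _ (B.chainFiltration_antitone hm h) ?_
        rw [add_comm]
        exact B.star_mem_chainFiltration le_rfl (by omega) (B.mem_chainFiltration_one b)
          (ih (by omega))
    simpa [Nat.sub_add_cancel hn] using key (n - 1) (by omega)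
  have e : B.affineStar (B.circ b c) - B.affineStar b =
      B.affineStar c + B.affineStar b * B.affineStar c := by
    have := B.one_add_affineStar_mul b c
    rw [mul_add, mul_one, add_mul, one_mul, add_assoc, add_right_inj] at this
    rw [← this]
    abel
  rw [e]
  refine Submodule.add_mem _ (B.affineStar_mem hn hc) ?_
  intro j v hv
  have h1 := B.affineStar_mem hn hc j v hv
  exact affineFiltration_antitone B.chainFiltration_antitone (Nat.le_succ _)
    (B.affineStar_mem le_rfl (B.mem_chainFiltration_one b) _ _ h1)

lemma one_add_affineStar_pow (a : A) (n : ℕ) :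
    ∃ b, (1 + B.affineStar a) ^ n = 1 + B.affineStar b := by
  induction n with
  | zero => exact ⟨0, by rw [affineStar_zero, pow_zero, add_zero]⟩
  | succ n ih =>
    obtain ⟨b, hb⟩ := ih
    exact ⟨_, by rw [pow_succ, hb, one_add_affineStar_mul]⟩

section

variable {k : ℕ} (hk : 0 < k) (hB : B.strongChain k = ⊥)
include hk hB

lemma isAlgFiltration_chain :
    IsAlgFiltration (endFiltration (affineFiltration B.chainFiltration)) k :=
  isAlgFiltration_affine hk B.chainFiltration_antitone (B.chainFiltration_eq_bot hk hB)

/-- The logarithm of the multiplicative group of a strongly nilpotent brace, in logarithmic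
coordinates on the brace. -/
lemma exists_log : ∃ X : A → Module.End (ZMod p) (ZMod p × A),
    (∀ n, 1 ≤ n → ∀ x ∈ B.chainFiltration n,
      X x ∈ endFiltration (affineFiltration B.chainFiltration) n) ∧
    (∀ x, X x (1, 0) = (0, x)) ∧
    (∀ x, ∃ a, truncExp p k (X x) = 1 + B.affineStar a) ∧
    (∀ a, ∃ x, truncExp p k (X x) = 1 + B.affineStar a) ∧
    ∀ Z ∈ endFiltration (affineFiltration B.chainFiltration) 1, ∀ a,
      truncExp p k Z = 1 + B.affineStar a → Z = X (Z (1, 0)).2 := by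
  have hG := B.isAlgFiltration_chain hk hB
  have hM := hG.isMulFiltration hk
  set G := endFiltration (affineFiltration B.chainFiltration)
  have hN1 : ∀ a, B.affineStar a ∈ G 1 :=
    fun a => B.affineStar_mem le_rfl (B.mem_chainFiltration_one a)
  have hbot := B.chainFiltration_eq_bot hk hB
  have eval : ∀ n, 1 ≤ n → ∀ f ∈ G n, (f (1, 0)).1 = 0 ∧ (f (1, 0)).2 ∈ B.chainFiltration n := by
    intro n hn f hf
    have := hf 0 (1, 0) (by rw [affineFiltration_zero]; trivial)
    rwa [zero_add, mem_affineFiltration (by omega)] at this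
  choose log hlog1 hlog using fun a => hM.exists_expSeries_eq hk (hN1 a)
  have hexp : ∀ a, truncExp p k (log a) = 1 + B.affineStar a := fun a => by
    rw [hG.truncExp_eq (hlog1 a), hlog]
  have hsub : ∀ n, 1 ≤ n → ∀ a b, a - b ∈ B.chainFiltration n →
      ((log a (1, 0)).2 - (log b (1, 0)).2) - (a - b) ∈ B.chainFiltration (n + 1) := by
    intro n hn a b hab
    have h1 := B.affineStar_sub_mem hn hab
    rw [← hlog a, ← hlog b] at h1
    have h2 := hM.sub_mem_of_expSeries_sub_mem hk (hlog1 a) (hlog1 b) (n := n)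
      (by rwa [max_eq_left hn])
    have h3 := hM.expSeries_sub_sub_mem hk (hlog1 a) (hlog1 b) h2
    rw [hlog, hlog, max_eq_left (by omega)] at h3
    have h4 := Submodule.neg_mem _ (eval _ (by omega) _ h3).2
    simpa using h4
  -- To leading order log a is S_a, and S_a(1, 0) = (0, a); so a ↦ (log a)(1, 0) is a contracting
  -- perturbation of the identity. Its inverse `ψ` gives the logarithmic coordinates.
  have hcon : IsContracting B.chainFiltration fun a => (log a (1, 0)).2 - a := by
    refine ⟨fun x _ => B.mem_chainFiltration_one _, fun n hn x _ y _ h => ?_⟩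
    have := hsub n hn x y h
    rwa [sub_sub_sub_comm] at this
  have hinj : ∀ n, ∀ a b, (log a (1, 0)).2 - (log b (1, 0)).2 ∈ B.chainFiltration n →
      a - b ∈ B.chainFiltration n := by
    intro n a b h
    exact hcon.sub_mem_of_add_sub_add_mem B.chainFiltration_antitone
      (B.mem_chainFiltration_one a) (B.mem_chainFiltration_one b) (by simpa using h)
  have hlog0 : log 0 = 0 := hM.expSeries_injOn hk (hlog1 0) (zero_mem _) (by
    rw [hlog, expSeries_zero, affineStar_zero])
  have hsurj : ∀ x, ∃ a, (log a (1, 0)).2 = x := by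
    intro x
    have := hcon.iterate_add B.chainFiltration_antitone hbot (B.mem_chainFiltration_one x)
    exact ⟨_, by simpa using this⟩
  choose ψ hψ using hsurj
  have hψ' : ∀ a, ψ (log a (1, 0)).2 = a := by
    intro a
    have := hinj k (ψ (log a (1, 0)).2) a (by rw [hψ, sub_self]; exact zero_mem _)
    rwa [hbot, Submodule.mem_bot, sub_eq_zero] at this
  refine ⟨fun x => log (ψ x), ?_, ?_, fun x => ⟨_, hexp _⟩, fun a => ⟨(log a (1, 0)).2, ?_⟩, ?_⟩
  · intro n hn x hx
    have h1 : ψ x ∈ B.chainFiltration n := by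
      simpa using hinj n (ψ x) 0 (by rw [hψ, hlog0]; simpa using hx)
    have := hM.mem_of_expSeries_mem hk (hlog1 (ψ x)) (n := n)
      (by rw [hlog, max_eq_left hn]; exact B.affineStar_mem hn h1)
    rwa [max_eq_left hn] at this
  · intro x
    exact Prod.ext (eval 1 le_rfl _ (hlog1 _)).1 (hψ x)
  · simp only [hψ', hexp]
  · intro Z hZ a hZa
    have : Z = log a := by
      refine hM.expSeries_injOn hk hZ (hlog1 a) ?_
      rw [hG.truncExp_eq hZ, add_right_inj] at hZa
      rw [hZa, hlog]
    simp only [this, hψ']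

end

end FieldBrace

/-! ### From braces to pre-Lie algebras: the logarithms form a Lie algebra. -/

namespace FieldBrace

variable {p : ℕ} [Fact p.Prime] {A : Type*} [AddCommGroup A] [Module (ZMod p) A]
  (B : FieldBrace (ZMod p) A)

variable {k : ℕ} (hk : 0 < k) (hp : 2 ^ k < p) (hB : B.strongChain k = ⊥)
  {X : A → Module.End (ZMod p) (ZMod p × A)}
  (hX : ∀ n, 1 ≤ n → ∀ x ∈ B.chainFiltration n,
    X x ∈ endFiltration (affineFiltration B.chainFiltration) n)
  (hX1 : ∀ x, X x (1, 0) = (0, x))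
  (hXexp : ∀ x, ∃ a, truncExp p k (X x) = 1 + B.affineStar a)
  (hXlog : ∀ Z ∈ endFiltration (affineFiltration B.chainFiltration) 1, ∀ a,
      truncExp p k Z = 1 + B.affineStar a → Z = X (Z (1, 0)).2)
include hk hp hB hX hX1 hXexp hXlog

/-- Every scalar is the class of a natural number n, and exp(n X_x) = exp(X_x)^n lies in the group;
uniqueness of logarithms identifies n X_x. -/
lemma log_smul (s : ZMod p) (x : A) : X (s • x) = s • X x := by
  have hG := B.isAlgFiltration_chain hk hB
  have hx := hX 1 le_rfl x (B.mem_chainFiltration_one x)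
  obtain ⟨n, rfl⟩ : ∃ n : ℕ, (n : ZMod p) = s := ⟨s.val, ZMod.natCast_zmod_val s⟩
  obtain ⟨a, ha⟩ := hXexp x
  obtain ⟨b, hb⟩ := B.one_add_affineStar_pow a n
  rw [Nat.cast_smul_eq_nsmul, Nat.cast_smul_eq_nsmul]
  have h := hXlog (n • X x) (Submodule.smul_of_tower_mem _ n hx) b
    (by rw [hG.truncExp_nsmul hp hk hx, ha, hb])
  rw [h, LinearMap.smul_apply, hX1]
  simp

lemma log_add (x y : A) : X (x + y) = X x + X y := by
  have hG := B.isAlgFiltration_chain hk hB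
  have hM := hG.isMulFiltration hk
  set G := endFiltration (affineFiltration B.chainFiltration)
  have smul := B.log_smul hk hp hB hX hX1 hXexp hXlog
  have hX0 : X 0 = 0 := by simpa using smul 0 0
  -- Descending induction on the depth j of y in the chain: once X is additive for increments of
  -- depth j + 1, it becomes additive for increments of depth j.
  have key : ∀ m j, j + m = k → 1 ≤ j → ∀ x, ∀ y ∈ B.chainFiltration j,
      X (x + y) = X x + X y := by
    intro m
    induction m with
    | zero =>
      intro j hj _ x y hy
      rw [show j = k by omega, B.chainFiltration_eq_bot hk hB, Submodule.mem_bot] at hy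
      rw [hy, hX0, add_zero, add_zero]
    | succ m ih =>
      intro j hj hj1 x y hy
      have step := ih (j + 1) (by omega) (by omega)
      have stepsum : ∀ (u : A) (s : Finset ℕ) (v : ℕ → A),
          (∀ i ∈ s, v i ∈ B.chainFiltration (j + 1)) →
          X (u + ∑ i ∈ s, v i) = X u + ∑ i ∈ s, X (v i) := by
        intro u s v hv
        induction s using Finset.cons_induction with
        | empty => simp
        | cons i s hi ihs =>
          rw [Finset.sum_cons, Finset.sum_cons, add_comm (v i), ← add_assoc,
            step _ _ (hv i (Finset.mem_cons_self i s)),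
            ihs fun i' hi' => hv i' (Finset.mem_cons_of_mem hi')]
          abel
      have hXx : X x ∈ G 1 := hX 1 le_rfl x (B.mem_chainFiltration_one x)
      have hXy : X y ∈ G 1 := hX 1 le_rfl y (B.mem_chainFiltration_one y)
      have hXyj : X y ∈ G j := hX j hj1 y hy
      let E := expSeries (LinearMap.mul (ZMod p) (Module.End (ZMod p) (ZMod p × A))) k
      have hlin : ∀ T ∈ G 1, (fun t : ZMod p => t • T) ∈ polyFun (fun n => G (max n 1)) k :=
        fun T hT => by
          simpa using monomial_mem_polyFun (C := fun n => G (max n 1)) (k := k) (i := 1)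
            (by omega) hT
      have hEx := hM.expSeries_mem_polyFun (hlin _ hXx)
      have hEy := hM.expSeries_mem_polyFun (hlin _ hXy)
      have hc := add_mem (add_mem hEx hEy) (hM.mul_mem_polyFun hEx hEy)
      obtain ⟨Z, hZ, hZc⟩ := hM.exists_polyFun_expSeries_eq hk hc
      -- As E = exp - 1, this says exp(Z(t)) = exp(t X_x) exp(t X_y).
      replace hZc : ∀ t, E (Z t) = E (t • X x) + E (t • X y) + E (t • X x) * E (t • X y) := hZc
      have hZ1 : ∀ t, Z t ∈ G 1 := fun t => hM.apply_mem_one hZ t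
      have hsm : ∀ T ∈ G 1, ∀ t : ZMod p, t • T ∈ G 1 := fun T hT t => Submodule.smul_mem _ t hT
      have hZX : ∀ t, Z t = X (Z t (1, 0)).2 := by
        intro t
        obtain ⟨a, ha⟩ := hXexp (t • x)
        obtain ⟨b, hb⟩ := hXexp (t • y)
        refine hXlog _ (hZ1 t) (B.circ a b) ?_
        rw [← one_add_affineStar_mul, ← ha, ← hb, smul, smul, hG.truncExp_eq (hZ1 t),
          hG.truncExp_eq (hsm _ hXx t), hG.truncExp_eq (hsm _ hXy t)]
        change 1 + E (Z t) = (1 + E _) * (1 + E _)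
        rw [hZc]
        noncomm_ring
      have hZ0 : Z 0 = 0 := hM.expSeries_injOn hk (hZ1 0) (zero_mem _) (by
        change E (Z 0) = E 0
        have : E 0 = 0 := expSeries_zero
        rw [hZc, zero_smul, zero_smul, this]
        simp)
      have hlin1 : ∀ T : Module.End (ZMod p) (ZMod p × A),
          polyCoeff 1 (fun t : ZMod p => t • T) = T := fun T => by
        simpa using polyCoeff_monomial hp hk hk hk T
      have hlin2 : ∀ i ≤ k, 2 ≤ i → ∀ T : Module.End (ZMod p) (ZMod p × A),
          polyCoeff i (fun t : ZMod p => t • T) = 0 := fun i hik hi T => by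
        have := polyCoeff_monomial hp hk hik hk T
        rw [if_neg (by omega)] at this
        simpa using this
      have hZcoeff1 : polyCoeff 1 Z = X x + X y := by
        rw [← hM.polyCoeff_one_expSeries hp hk hZ hZ0]
        have e : (fun t => expSeries (LinearMap.mul (ZMod p) _) k (Z t)) =
            (fun t => E (t • X x)) + (fun t => E (t • X y)) +
              fun t => LinearMap.mul (ZMod p) _ (E (t • X x)) (E (t • X y)) := by
          ext1 t
          exact hZc t
        have hE0 : ∀ T, E ((0 : ZMod p) • T) = 0 := fun T => by
          rw [zero_smul]; exact expSeries_zero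
        rw [e, map_add, map_add, polyCoeff_one_map₂ hp hk hM.mul_mem hM.anti hM.bot hEx hEy]
        change polyCoeff 1 (fun t => expSeries _ k _) + polyCoeff 1 (fun t => expSeries _ k _) +
          (_ * E _ + E _ * _) = _
        rw [hM.polyCoeff_one_expSeries hp hk (hlin _ hXx) (zero_smul _ _),
          hM.polyCoeff_one_expSeries hp hk (hlin _ hXy) (zero_smul _ _), hE0, hE0, hlin1, hlin1]
        simp
      -- Modulo step j + 1 the series E is affine along the increment t X_y of depth j, and the
      -- cross product E(t X_x) E(t X_y) has depth j + 1; so Z(t) agrees with t (X_x + X_y) there.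
      have hZsub : ∀ t, Z t - t • (X x + X y) ∈ G (j + 1) := by
        intro t
        have hty : t • X y ∈ G j := Submodule.smul_mem _ t hXyj
        have h1 := hM.expSeries_sub_sub_mem hk (x := t • X x + t • X y) (y := t • X x) (n := j)
          (Submodule.add_mem _ (hsm _ hXx t) (hsm _ hXy t)) (hsm _ hXx t)
          (by rw [add_sub_cancel_left, max_eq_left hj1]; exact hty)
        have h2 := hM.expSeries_sub_sub_mem hk (x := t • X y) (y := 0) (n := j)
          (hsm _ hXy t) (zero_mem _) (by rw [sub_zero, max_eq_left hj1]; exact hty)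
        have h3 : E (t • X y) ∈ G j := by
          have := hM.expSeries_mem (x := t • X y) (n := j) (by rw [max_eq_left hj1]; exact hty)
          rwa [max_eq_left hj1] at this
        have h4 : E (t • X x) * E (t • X y) ∈ G (1 + j) :=
          hG.mul_mem _ _ _ _ (hM.expSeries_mem (n := 1) (hsm _ hXx t)) h3
        rw [max_eq_left (by omega)] at h1 h2
        rw [add_comm 1 j] at h4
        have h5 := Submodule.sub_mem _ (Submodule.add_mem _ h2 h4) h1
        have h6 := hM.sub_mem_of_expSeries_sub_mem hk (hZ1 t)
          (Submodule.add_mem _ (hsm _ hXx t) (hsm _ hXy t)) (n := j + 1) (by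
            rw [max_eq_left (by omega)]
            change E (Z t) - E _ ∈ _
            rw [hZc]
            convert h5 using 1
            rw [expSeries_zero]
            simp only [E]
            abel)
        rwa [max_eq_left (by omega), ← smul_add] at h6
      have hZcoeff : ∀ i ≤ k, 2 ≤ i → polyCoeff i Z ∈ G (j + 1) := by
        intro i hik hi
        have := polyCoeff_mem i (Z - fun t => t • (X x + X y)) (G (j + 1)) hZsub
        rwa [map_sub, hlin2 i hik hi, sub_zero] at this
      have hz : ∀ i ≤ k, 2 ≤ i → (polyCoeff i Z (1, 0)).2 ∈ B.chainFiltration (j + 1) := by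
        intro i hik hi
        have := hZcoeff i hik hi 0 (1, 0) (by rw [affineFiltration_zero]; trivial)
        rw [zero_add, mem_affineFiltration (by omega)] at this
        exact this.2
      obtain ⟨k, rfl⟩ : ∃ l, k = l + 2 := ⟨k - 2, by omega⟩
      have hZsum : ∀ t, Z t =
          ∑ i ∈ range k, t ^ (i + 2) • polyCoeff (i + 2) Z + t • (X x + X y) := by
        intro t
        rw [eq_sum_polyCoeff hp hZ t, Finset.sum_range_succ', Finset.sum_range_succ',
          polyCoeff_zero_eq hp hk hZ, hZ0, ← hZcoeff1]
        simp
      -- Applying X to the expansion of Z(t)(1, 0) is allowed by the induction hypothesis, since the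
      -- coefficients of degree at least 2 have depth j + 1. The linear coefficient is now X(x + y),
      -- whereas by `hZcoeff1` it is X_x + X_y.
      have hZsum' : ∀ t, Z t = ∑ i ∈ range (k + 2), t ^ i •
          (if i = 0 then 0 else if i = 1 then X (x + y) else X (polyCoeff i Z (1, 0)).2) := by
        intro t
        rw [hZX t, hZsum t, Finset.sum_range_succ', Finset.sum_range_succ']
        have e : ((∑ i ∈ range k, t ^ (i + 2) • polyCoeff (i + 2) Z + t • (X x + X y))
            (1, 0)).2 = t • (x + y) +
              ∑ i ∈ range k, t ^ (i + 2) • (polyCoeff (i + 2) Z (1, 0)).2 := by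
          simp [Prod.snd_sum, hX1, add_comm]
        rw [e, stepsum, smul, add_comm]
        · simp [smul]
        · intro i hi
          have := Finset.mem_range.1 hi
          exact Submodule.smul_mem _ _ (hz (i + 2) (by omega) (by omega))
      have := polyCoeff_sum hp hk (m := 1) hk fun i =>
        if i = 0 then 0 else if i = 1 then X (x + y) else X (polyCoeff i Z (1, 0)).2
      simp only [← hZsum'] at this
      change polyCoeff 1 Z = _ at this
      rw [hZcoeff1] at this
      simpa using this.symm
  exact key (k - 1) 1 (by omega) le_rfl x y (B.mem_chainFiltration_one y)

lemma log_lie (x y : A) :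
    X x * X y - X y * X x = X ((X x (0, y)).2 - (X y (0, x)).2) := by
  have hG := B.isAlgFiltration_chain hk hB
  have hM := hG.isMulFiltration hk
  set G := endFiltration (affineFiltration B.chainFiltration)
  have smul := B.log_smul hk hp hB hX hX1 hXexp hXlog
  have add := B.log_add hk hp hB hX hX1 hXexp hXlog
  have mem : ∀ x, X x ∈ G 1 := fun x => hX 1 le_rfl x (B.mem_chainFiltration_one x)
  let XL : A →ₗ[ZMod p] Module.End (ZMod p) (ZMod p × A) :=
    { toFun := X, map_add' := add, map_smul' := smul }
  have hXL : ∀ a, XL a = X a := fun _ => rfl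
  let ev : Module.End (ZMod p) (ZMod p × A) →ₗ[ZMod p] A :=
    LinearMap.snd (ZMod p) (ZMod p) A ∘ₗ LinearMap.applyₗ (1, 0)
  have hf := hG.truncExp_linear_mem hk (mem x)
  have hf' := hG.truncExp_linear_mem hk (mem (-x))
  have coeff : ∀ x, polyCoeff 1 (fun t : ZMod p => truncExp p k (t • X x)) = X x := by
    intro x
    have hlin : (fun t : ZMod p => t • X x) ∈ polyFun (fun n => G (max n 1)) k := by
      rcases (Nat.succ_le_of_lt hk).eq_or_lt with h | h
      · have : X x = 0 := hG.eq_zero h.symm.le (mem x)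
        simp only [this, smul_zero]
        exact zero_mem _
      · simpa using monomial_mem_polyFun (C := fun n => G (max n 1)) (i := 1) h (mem x)
    have e : (fun t : ZMod p => truncExp p k (t • X x)) =
        (fun t : ZMod p => t ^ 0 • 1) +
          fun t => expSeries (LinearMap.mul (ZMod p) _) k (t • X x) := by
      ext1 t
      rw [hG.truncExp_eq (Submodule.smul_mem _ t (mem x))]
      simp
    rw [e, map_add, polyCoeff_monomial hp hk hk hk.le,
      hM.polyCoeff_one_expSeries hp hk hlin (zero_smul _ _), if_neg (by omega), zero_add]
    simpa using polyCoeff_monomial hp hk hk hk (X x)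
  -- Conjugating X_y by exp(t X_x) gives the logarithm of a group element, so Y(t) stays in the
  -- image of X. As X is linear, this image also contains the linear coefficient of Y, which is the
  -- commutator; evaluating at (1, 0) finds its preimage.
  let Y : ZMod p → Module.End (ZMod p) (ZMod p × A) := fun t =>
    truncExp p k (t • X x) * (X y * truncExp p k (t • X (-x)))
  have neg : ∀ t : ZMod p, t • X (-x) = -(t • X x) := fun t => by
    rw [← hXL, map_neg, hXL, smul_neg]
  have inv : ∀ t : ZMod p, truncExp p k (t • X (-x)) * truncExp p k (t • X x) = 1 := by
    intro t
    have := hG.truncExp_mul_truncExp_neg hp hk (Submodule.smul_mem _ t (mem (-x)))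
    rwa [neg, neg_neg, ← neg] at this
  have hY : ∀ t, Y t = XL (ev (Y t)) := by
    intro t
    have hpow : ∀ n, Y t ^ n =
        truncExp p k (t • X x) * (X y ^ n * truncExp p k (t • X (-x))) := by
      intro n
      induction n with
      | zero =>
        have := hG.truncExp_mul_truncExp_neg hp hk (Submodule.smul_mem _ t (mem x))
        rw [← neg] at this
        rw [pow_zero, pow_zero, one_mul, this]
      | succ n ih =>
        rw [pow_succ, ih, pow_succ]
        simp only [Y]
        rw [mul_assoc, mul_assoc, ← mul_assoc (truncExp p k (t • X (-x))), inv, one_mul,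
          mul_assoc]
    have hexp : truncExp p k (Y t) =
        truncExp p k (t • X x) * (truncExp p k (X y) * truncExp p k (t • X (-x))) := by
      rw [truncExp, Finset.sum_congr rfl fun n _ => by rw [hpow n]]
      rw [truncExp.eq_def p k (X y), Finset.sum_mul, Finset.mul_sum]
      exact Finset.sum_congr rfl fun n _ => by rw [smul_mul_assoc, mul_smul_comm]
    obtain ⟨a, ha⟩ := hXexp (t • x)
    obtain ⟨b, hb⟩ := hXexp y
    obtain ⟨c, hc⟩ := hXexp (t • -x)
    have hmem0 : ∀ f ∈ polyFun G k, ∀ t, f t ∈ G 0 := fun f hf t =>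
      apply_mem_of_mem_polyFun (fun i _ => hG.anti (Nat.zero_le i)) hf t
    refine hXlog (Y t) ?_ (B.circ a (B.circ b c)) ?_
    · have := hG.mul_mem _ _ _ _ (hmem0 _ hf t) (hG.mul_mem _ _ _ _ (mem y) (hmem0 _ hf' t))
      exact this
    · rw [hexp, ← one_add_affineStar_mul, ← one_add_affineStar_mul, ← ha, ← hb, ← hc, smul, smul]
  have hYcoeff : polyCoeff 1 Y = X x * X y - X y * X x := by
    have hg : (fun t : ZMod p => X y * truncExp p k (t • X (-x))) ∈ polyFun G k :=
      hG.mul_mem_polyFun (const_mem_polyFun hk (hG.anti (Nat.zero_le 1) (mem y))) hf'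
    have h1 := polyCoeff_one_map₂ (β := LinearMap.mul (ZMod p) _) hp hk
      (fun i j a b => hG.mul_mem i j a b) hG.anti hG.bot hf hg
    have h2 := polyCoeff_map 1 (fun t : ZMod p => truncExp p k (t • X (-x)))
      (LinearMap.mulLeft (ZMod p) (X y))
    simp only [LinearMap.mulLeft_apply, coeff] at h2
    simp only [LinearMap.mul_apply', coeff, h2, zero_smul, truncExp_zero hk, mul_one,
      one_mul] at h1
    change polyCoeff 1 (fun t => Y t) = _
    simp only [Y]
    rw [h1, ← hXL (-x), map_neg, hXL]
    exact (congrArg (X x * X y + ·) (mul_neg (X y) (X x))).trans (sub_eq_add_neg _ _).symm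
  have h1 : polyCoeff 1 Y = XL (ev (polyCoeff 1 Y)) := by
    rw [← polyCoeff_map, ← polyCoeff_map]
    congr 1
    ext1 t
    exact hY t
  rw [hYcoeff, hXL] at h1
  rw [h1]
  congr 1
  simp [ev, hX1]

omit hX hX1 hXexp hXlog in
/-- A strongly nilpotent brace is the group of flows of a nilpotent pre-Lie algebra. -/
lemma exists_preLieStructure : ∃ P : PreLieStructure (ZMod p) A,
    (∀ x, P.IsProduct k x → x = 0) ∧ ∀ a b, P.flow k a b = B.circ a b := by
  obtain ⟨X, hX, hX1, hXexp, hXsurj, hXlog⟩ := B.exists_log hk hB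
  have smul := B.log_smul hk hp hB hX hX1 hXexp hXlog
  have add := B.log_add hk hp hB hX hX1 hXexp hXlog
  have lie := B.log_lie hk hp hB hX hX1 hXexp hXlog
  have hX0 : ∀ x b, X x (0, b) = (0, (X x (0, b)).2) := by
    intro x b
    have := hX 1 le_rfl x (B.mem_chainFiltration_one x) 0 (0, b)
      (by rw [affineFiltration_zero]; trivial)
    rw [mem_affineFiltration (by omega)] at this
    exact Prod.ext this.1 rfl
  -- The product is x · y = X_x(0, y). The commutator formula, evaluated at (0, z), is precisely the
  -- pre-Lie identity.
  let P : PreLieStructure (ZMod p) A :=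
    { mul := LinearMap.mk₂ (ZMod p) (fun a b => (X a (0, b)).2)
        (fun a b c => by rw [add]; rfl) (fun s a b => by rw [smul]; rfl)
        (fun a b c => by rw [← Prod.snd_add, ← map_add]; simp)
        (fun s a b => by rw [← Prod.smul_snd, ← map_smul]; simp)
      preLie := by
        intro x y z
        have h := congrArg (fun f => (f (0, z)).2) (lie x y)
        simp only [LinearMap.sub_apply, Module.End.mul_apply, Prod.snd_sub] at h
        rw [hX0 y z, hX0 x z] at h
        have h2 : X ((X x (0, y)).2 - (X y (0, x)).2) =
            X (X x (0, y)).2 - X (X y (0, x)).2 := by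
          have := add ((X x (0, y)).2 - (X y (0, x)).2) (X y (0, x)).2
          rw [sub_add_cancel] at this
          rw [this, add_sub_cancel_right]
        rw [h2, LinearMap.sub_apply, Prod.snd_sub] at h
        simp only [LinearMap.mk₂_apply]
        rw [sub_eq_sub_iff_add_eq_add] at h ⊢
        rw [add_comm _ ((X x) (0, _)).2, h, add_comm] }
  have hmul : ∀ a b, P.mul a b = (X a (0, b)).2 := fun _ _ => rfl
  have hprod : ∀ n x, P.IsProduct n x → x ∈ B.chainFiltration n := by
    intro n x hx
    induction hx with
    | single a => exact B.mem_chainFiltration_one a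
    | @mul m n a b ha hb iha ihb =>
      have := hX m ha.pos a iha n (0, b) ((mem_affineFiltration (by have := hb.pos; omega)).2
        ⟨rfl, ihb⟩)
      rw [mem_affineFiltration (by have := hb.pos; omega)] at this
      rw [hmul, add_comm]
      exact this.2
  have hP : ∀ x, P.IsProduct k x → x = 0 := by
    intro x hx
    have := hprod k x hx
    rwa [B.chainFiltration_eq_bot hk hB, Submodule.mem_bot] at this
  refine ⟨P, hP, fun a b => ?_⟩
  obtain ⟨x, hx⟩ := hXsurj a
  -- Hence exp of the affine operator of x is 1 + S_a: its value at (1, 0) gives W(x) = a, and its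
  -- value at (0, b) gives e^{L_x}(b) = b + a * b.
  have hXP : affineMul P.mul x = X x := by
    refine LinearMap.ext fun v => ?_
    have e : v = v.1 • (1, 0) + (0, v.2) := by ext <;> simp
    have h0 : X x (0, 0) = 0 := map_zero (X x)
    rw [e, map_add, map_add, map_smul, map_smul, hX1, hX0]
    ext <;> simp [hmul, h0]
  rw [← hXP] at hx
  have h1 := congrArg (fun f => (f (1, 0)).2) hx
  have h2 := congrArg (fun f => (f (0, b)).2) hx
  simp only [PreLieStructure.truncExp_affineMul_apply hk hP] at h1 h2
  have hW : P.W k x = a := by simpa [PreLieStructure.expL] using h1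
  rw [PreLieStructure.flow, PreLieStructure.Ω_eq_of_W_eq hk hP hW, circ_eq]
  simp only [zero_smul, zero_add] at h2
  rw [h2]
  simp [add_assoc]

end FieldBrace

/-! ### The bijection and its compatibility with isomorphisms. -/

section Correspondence

variable {k p : ℕ} [Fact p.Prime] {A : Type*} [AddCommGroup A] [Module (ZMod p) A]

lemma FieldBrace.ext_circ {F A : Type*} [Field F] [AddCommGroup A] [Module F A]
    {B B' : FieldBrace F A} (h : ∀ a b, B.circ a b = B'.circ a b) : B = B' :=
  FieldBrace.ext (funext fun a => funext fun b => h a b)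

lemma PreLieStructure.ext_mul {F A : Type*} [Field F] [AddCommGroup A] [Module F A]
    {P P' : PreLieStructure F A} (h : ∀ a b, P.mul a b = P'.mul a b) : P = P' :=
  PreLieStructure.ext (LinearMap.ext₂ h)

/-- The brace attached to a pre-Lie algebra of nilpotency index `k` has nilpotency index `k`. -/
def flowBraceOfIndex (hp : 2 ^ k < p)
    (P : {P : PreLieStructure (ZMod p) A // P.HasNilpotencyIndex k}) :
    {B : FieldBrace (ZMod p) A // B.HasNilpotencyIndex k} :=
  ⟨PreLieStructure.flowBrace P.2.1.1 P.2.1.2 hp,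
    (PreLieStructure.flowBrace_hasNilpotencyIndex_iff P.2.1.1 P.2.1.2 hp k).2 P.2⟩

lemma flowBraceOfIndex_dot (hp : 2 ^ k < p)
    (P : {P : PreLieStructure (ZMod p) A // P.HasNilpotencyIndex k}) (a b : A) :
    (flowBraceOfIndex hp P).1.dot a b = P.1.mul a b :=
  PreLieStructure.flowBrace_dot P.2.1.1 P.2.1.2 hp a b

/-- Injectivity holds because the product is recovered from the brace as `dot`; surjectivity is
`exists_preLieStructure`, with the index transported along the equality of braces. -/
lemma flowBraceOfIndex_bijective (hp : 2 ^ k < p) :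
    Function.Bijective (flowBraceOfIndex (A := A) hp) := by
  refine ⟨fun P P' h => Subtype.ext (PreLieStructure.ext_mul fun a b => ?_), fun B => ?_⟩
  · rw [← flowBraceOfIndex_dot hp, ← flowBraceOfIndex_dot hp, h]
  · obtain ⟨P, hP, hflow⟩ := B.1.exists_preLieStructure B.2.1.1 hp B.2.1.2
    have hPB : PreLieStructure.flowBrace B.2.1.1 hP hp = B.1 := FieldBrace.ext_circ hflow
    refine ⟨⟨P, ?_⟩, Subtype.ext hPB⟩
    rw [← PreLieStructure.flowBrace_hasNilpotencyIndex_iff B.2.1.1 hP hp, hPB]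
    exact B.2

/-- The correspondence between pre-Lie algebras and braces of nilpotency index `k`. -/
def flowEquiv (hp : 2 ^ k < p) :
    {P : PreLieStructure (ZMod p) A // P.HasNilpotencyIndex k} ≃
      {B : FieldBrace (ZMod p) A // B.HasNilpotencyIndex k} :=
  Equiv.ofBijective _ (flowBraceOfIndex_bijective hp)

variable {A' : Type*} [AddCommGroup A'] [Module (ZMod p) A']

lemma PreLieStructure.map_pow_apply {P : PreLieStructure (ZMod p) A}
    {P' : PreLieStructure (ZMod p) A'} (e : A ≃ₗ[ZMod p] A')
    (h : ∀ a b, e (P.mul a b) = P'.mul (e a) (e b)) (n : ℕ) (a b : A) :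
    e (((P.mul a) ^ n) b) = ((P'.mul (e a)) ^ n) (e b) := by
  induction n with
  | zero => simp
  | succ n ih => simp [pow_succ', h, ih]

lemma PreLieStructure.map_flow {P : PreLieStructure (ZMod p) A}
    {P' : PreLieStructure (ZMod p) A'} (hk : 0 < k) (hP : ∀ x, P.IsProduct k x → x = 0)
    (hP' : ∀ x, P'.IsProduct k x → x = 0) (e : A ≃ₗ[ZMod p] A')
    (h : ∀ a b, e (P.mul a b) = P'.mul (e a) (e b)) (a b : A) :
    e (P.flow k a b) = P'.flow k (e a) (e b) := by
  have hΩ : P'.Ω k (e a) = e (P.Ω k a) := by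
    refine PreLieStructure.Ω_eq_of_W_eq hk hP' ?_
    conv_rhs => rw [← PreLieStructure.W_Ω hk hP a]
    simp [PreLieStructure.W, map_pow_apply e h]
  rw [flow, flow, hΩ]
  simp [PreLieStructure.expL, map_pow_apply e h]

lemma FieldBrace.map_dot {B : FieldBrace (ZMod p) A} {B' : FieldBrace (ZMod p) A'}
    (e : A ≃ₗ[ZMod p] A') (h : ∀ a b, e (B.circ a b) = B'.circ (e a) (e b)) (a b : A) :
    e (B.dot a b) = B'.dot (e a) (e b) := by
  simp only [dot, map_neg, map_sum, map_smul, LeftBrace.star, map_sub, h, map_nsmul]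

end Correspondence

end

theorem mainTheorem1 (k p : ℕ) [Fact p.Prime] (hp : 2 ^ k < p) :
    ∃ Φ : ∀ (A : Type u) [AddCommGroup A] [Module (ZMod p) A],
        {P : PreLieStructure (ZMod p) A // P.HasNilpotencyIndex k} ≃
          {B : FieldBrace (ZMod p) A // B.HasNilpotencyIndex k},
      -- a pre-Lie algebra is sent to its group of flows
      (∀ (A : Type u) [AddCommGroup A] [Module (ZMod p) A]
          (P : {P : PreLieStructure (ZMod p) A // P.HasNilpotencyIndex k}),
        Function.Bijective (P.1.W k) ∧
          ∀ a b : A, (Φ A P).1.circ a b = P.1.flow k a b) ∧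
      -- the inverse map sends a brace to the stated pre-Lie product
      (∀ (A : Type u) [AddCommGroup A] [Module (ZMod p) A]
          (B : {B : FieldBrace (ZMod p) A // B.HasNilpotencyIndex k}),
        ∀ a b : A, ((Φ A).symm B).1.mul a b = B.1.dot a b) ∧
      -- isomorphisms of pre-Lie algebras are the same as isomorphisms of braces
      (∀ (A A' : Type u) [AddCommGroup A] [Module (ZMod p) A]
          [AddCommGroup A'] [Module (ZMod p) A']
          (P : {P : PreLieStructure (ZMod p) A // P.HasNilpotencyIndex k})
          (P' : {P : PreLieStructure (ZMod p) A' // P.HasNilpotencyIndex k})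
          (e : A ≃ₗ[ZMod p] A'),
        (∀ a b : A, e (P.1.mul a b) = P'.1.mul (e a) (e b)) ↔
          ∀ a b : A, e ((Φ A P).1.circ a b) = (Φ A' P').1.circ (e a) (e b)) := by
  refine ⟨fun A _ _ => flowEquiv hp, ?_, ?_, ?_⟩
  · intro A _ _ P
    exact ⟨PreLieStructure.W_bijective P.2.1.1 P.2.1.2, fun a b => rfl⟩
  · intro A _ _ B a b
    obtain ⟨P, rfl⟩ := (flowEquiv hp).surjective B
    rw [Equiv.symm_apply_apply]
    exact (flowBraceOfIndex_dot hp P a b).symm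
  · intro A A' _ _ _ _ P P' e
    constructor
    · intro h
      exact PreLieStructure.map_flow P.2.1.1 P.2.1.2 P'.2.1.2 e h
    · intro h a b
      rw [← flowBraceOfIndex_dot hp P, ← flowBraceOfIndex_dot hp P']
      exact FieldBrace.map_dot e h a b
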